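/- Let $q$ be an odd prime power, let $m$ be a positive integer with $\nu=\nu_2(m)\in\{1,2\}$ (so $m\equiv 2^{\nu}\pmod{2^{\nu+1}}$), assume $m\ge 2^{\nu}+2^{\nu+1}$, and put $n=\frac{q^m+1}{2}$. For a positive integer $N$ coprime to $q$ and $0\le s<N$ let $C_s=\{sq^j \bmod N: j\ge 0\}\subseteq\{0,\dots,N-1\}$ be the $q$-cyclotomic coset of $s$ modulo $N$; $s$ is a coset leader modulo $N$ if $s=\min C_s$. Put $$\Psi_q(x)=\frac{q-1}{2}\prod_{j=0}^{x}\bigl(q^{2^j}-1\bigr)\qquad (x\ge 0).$$ Let $\delta_i$ denote the $i$-th largest coset leader modulo $q^m+1$, and $\delta_i^2$ (the superscript is an index) the $i$-th largest coset leader modulo $n$. Then $$\delta_2=\frac{q^m+1}{q^{2^{\nu}}+1}\,\Psi_q(\nu-1),\qquad \delta_3=\delta_2-2\cdot\frac{\delta_2+\Psi_q(\nu)}{q^{2^{\nu+1}}},$$ $$\delta_4=\begin{cases}\delta_3-2q^{2^{\nu-1}}\Psi_q(\nu-1), & m=2^{\nu}+2^{\nu+1},\\ \delta_3-2\Psi_q(\nu),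 & m>2^{\nu}+2^{\nu+1},\end{cases}$$ and $\delta_1^2=\delta_2/2$, $\delta_2^2=\delta_3/2$, $\delta_3^2=\delta_4/2$. The $q$-cyclotomic cosets modulo $n$ satisfy $|C_{\delta_1^2}|=2^{\nu+1}$ and $|C_{\delta_2^2}|=|C_{\delta_3^2}|=2m$. Let $\beta$ be a primitive $n$-th root of unity in an extension field of $\mathbb F_q$. For an integer $\delta\ge 2$ let $\mathcal C_{(q,n,\delta,0)}$ be the BCH code, i.e. the cyclic code of length $n$ over $\mathbb F_q$ (an ideal of $\mathbb F_q[x]/\langle x^n-1\rangle$, identified with a subspace of $\mathbb F_q^n$) generated by the least common multiple of the minimal polynomials over $\mathbb F_q$ of $\beta^0,\beta^1,\dots,\beta^{\delta-2}$. A linear code $\mathcal C$ with Euclidean dual $\mathcal C^\perp$ is LCD if $\mathcal C\cap\mathcal C^{\perp}=\{0\}$. Then: 1. for $i=1,2$ and every integer $\delta$ with $\delta_{i+1}^2+1\le\delta\le\delta_i^2$, the code $\mathcal C_{(q,n,\delta+1,0)}$ is an LCD code of dimension $2m(i-1)+2^{\nu+1}$ and minimum distance $d\ge 2\delta$; 2.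 the code $\mathcal C_{(q,n,\delta_3^2+1,0)}$ is an LCD code of dimension $4m+2^{\nu+1}$ and minimum distance $d\ge 2\delta_3^2$. -/

import Mathlib

open Polynomial

/-- The `q`-cyclotomic coset of `s` modulo `n`, as a set of residues in `{0, …, n - 1}`. -/
def cyclotomicCoset (q n s : ℕ) : Set ℕ :=
  {x | ∃ j : ℕ, x = s * q ^ j % n}

/-- The set of coset leaders modulo `n`: the `s` with `0 ≤ s < n` that are the smallest element
of their own coset (the residues in a coset are `< n`, so membership of `s` forces `s < n`). -/
def cosetLeaders (q n : ℕ) : Set ℕ :=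
  {s | IsLeast (cyclotomicCoset q n s) s}

/-- `s` is the `i`-th largest coset leader modulo `n` (`i = 1` is the largest). -/
def IsNthLargestCosetLeader (q n i s : ℕ) : Prop :=
  s ∈ cosetLeaders q n ∧ {t ∈ cosetLeaders q n | s < t}.ncard + 1 = i

/-- `Ψ_q(x) = (q - 1) / 2 * ∏_{j = 0}^{x} (q ^ (2 ^ j) - 1)` for `x ≥ 0`, and `(q - 1) / 2` for
`x < 0`. -/
def Psi (q : ℕ) (x : ℤ) : ℚ :=
  if 0 ≤ x then ((q : ℚ) - 1) / 2 * ∏ j ∈ Finset.range (x.toNat + 1), ((q : ℚ) ^ (2 ^ j) - 1)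
  else ((q : ℚ) - 1) / 2

noncomputable section

/-- The polynomial `c_0 + c_1 x + ⋯ + c_{n-1} x^{n-1}` of a vector. -/
def wordPoly {K : Type*} [Field K] {n : ℕ} (c : Fin n → K) : K[X] :=
  ∑ i : Fin n, Polynomial.C (c i) * X ^ (i : ℕ)

/-- The cyclic code of length `n` generated by `g`: the vectors whose class in `K[x] / (x^n - 1)`
lies in the ideal generated by `g`. -/
def cyclicCode {K : Type*} [Field K] (n : ℕ) (g : K[X]) : Submodule K (Fin n → K) where
  carrier := {c | Ideal.Quotient.mk (Ideal.span {(X ^ n - 1 : K[X])}) (wordPoly c) ∈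
    Ideal.span {Ideal.Quotient.mk (Ideal.span {(X ^ n - 1 : K[X])}) g}}
  add_mem' := by
    intro a b ha hb
    have h : wordPoly (a + b) = wordPoly a + wordPoly b := by
      simp [wordPoly, add_mul, Finset.sum_add_distrib]
    simp only [Set.mem_ofPred_eq] at *
    rw [h, map_add]
    exact Ideal.add_mem _ ha hb
  zero_mem' := by simp [wordPoly]
  smul_mem' := by
    intro r a ha
    have h : wordPoly (r • a) = Polynomial.C r * wordPoly a := by
      simp [wordPoly, Finset.mul_sum, mul_assoc]
    simp only [Set.mem_ofPred_eq] at *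
    rw [h, map_mul]
    exact Ideal.mul_mem_left _ _ ha

open Classical in
/-- The generator polynomial of the BCH code: the (monic) least common multiple of the minimal
polynomials over `K` of `β ^ b, β ^ (b + 1), …, β ^ (b + δ - 2)`. -/
def bchGenerator (K : Type*) [Field K] {L : Type*} [Field L] [Algebra K L] (β : L) (δ : ℕ)
    (b : ℤ) : K[X] :=
  letI : NormalizedGCDMonoid K[X] := UniqueFactorizationMonoid.toNormalizedGCDMonoid K[X]
  (Finset.range (δ - 1)).lcm fun j => minpoly K (β ^ (b + (j : ℤ)))

open Classical in
theorem bchGenerator_dvd_iff (K : Type*) [Field K] {L : Type*} [Field L] [Algebra K L] (β : L)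
    (δ : ℕ) (b : ℤ) (p : K[X]) :
    bchGenerator K β δ b ∣ p ↔ ∀ j ∈ Finset.range (δ - 1), minpoly K (β ^ (b + (j : ℤ))) ∣ p := by
  let _ : NormalizedGCDMonoid K[X] := UniqueFactorizationMonoid.toNormalizedGCDMonoid K[X]
  exact Finset.lcm_dvd_iff

/-- The BCH code of length `n` over `K` with designed distance `δ` and offset `b`, with respect to
the primitive `n`-th root of unity `β` in an extension field of `K`. -/
def bchCode (K : Type*) [Field K] {L : Type*} [Field L] [Algebra K L] (n : ℕ) (β : L) (δ : ℕ)
    (b : ℤ) : Submodule K (Fin n → K) :=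
  cyclicCode n (bchGenerator K β δ b)

/-- The Euclidean dual of a linear code. -/
def dualCode {K : Type*} [Field K] {n : ℕ} (C : Submodule K (Fin n → K)) :
    Submodule K (Fin n → K) where
  carrier := {x | ∀ y ∈ C, x ⬝ᵥ y = 0}
  add_mem' := by
    intro a b ha hb y hy
    rw [add_dotProduct, ha y hy, hb y hy, add_zero]
  zero_mem' := by
    intro y _
    exact zero_dotProduct y
  smul_mem' := by
    intro r a ha y hy
    rw [smul_dotProduct, ha y hy, smul_zero]

/-- A linear code with complementary dual. -/
def IsLCD {K : Type*} [Field K] {n : ℕ} (C : Submodule K (Fin n → K)) : Prop :=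
  C ⊓ dualCode C = ⊥

open Classical in
/-- The minimum Hamming distance between distinct codewords. -/
def minDist {K : Type*} [Field K] {n : ℕ} (C : Submodule K (Fin n → K)) : ℕ :=
  sInf {d | ∃ x ∈ C, ∃ y ∈ C, x ≠ y ∧ hammingDist x y = d}

/-- `C` is an LCD code of length `n` and dimension `k`, with minimum distance at least `d`. -/
def IsLCDWithParams {K : Type*} [Field K] {n : ℕ} (C : Submodule K (Fin n → K)) (k d : ℕ) :
    Prop :=
  IsLCD C ∧ Module.finrank K C = k ∧ d ≤ minDist C

end

/-! ### Antiperiodic binary words and their lexicographic order -/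

/-! Write q^m + 1 = 2n. Since q is odd, n is fixed by multiplication by q modulo 2n, and it is the
largest coset leader. For a leader s < n put u_j = n - (s q^j mod 2n), the least absolute residue of
(n - s) q^j, and let b_j record whether u_j is negative. As q^m ≡ -1, the word b is antiperiodic
with antiperiod m. If q(n - s) < 2n, then u_{j+1} = q u_j - 2n(b_{j+1} - b_j), so b determines all
u_j, and n - s = (q-1) ∑ b_k q^{m-1-k} + 1. Larger values belong to lexicographically larger words,
and minimality of s, that is |u_j| ≤ u_0, says that b is the largest of its normalised shifts
(`exists_isTopWord`, `mem_cosetLeaders_of_isTopWord`). Finding the leaders just below n thus becomes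
finding the smallest top words, a problem without q.

That problem is solved by renormalisation. A top word of antiperiod 2m that is at most `muMax` is
the Thue-Morse image of a top word of antiperiod m (`IsTopWord.exists_mu`), so `FirstThree` passes
from m to 2m. With m = 2^ν p, p odd, it remains to treat odd p ≥ 5 (`firstThree_of_odd`) and, for p
= 3, antiperiod 6 (`firstThree_six`). On values, the substitution turns q into q² and multiplies the
leader by (q-1)/(q+1) (`wordDefect_mu`); Ψ obeys the same rule, so the formulas for ν = 2 follow
from those for ν = 1.

Because m is even, n is odd. The leaders found are even, and halving them gives the leaders modulo
n. A word that strictly exceeds its other normalised shifts within an antiperiod l has minimal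
period 2l, which is the coset size (`ncard_cyclotomicCoset`).

For the codes, q^m ≡ -1 modulo n makes the set of zeros symmetric. This yields the LCD property and
2δ-1 consecutive zeros around 0, hence d ≥ 2δ. The dimension is the total size of the cosets with
leader at least δ (`bchCode_params`). -/

theorem toLex_lt_iff {a b : ℕ → Bool} :
    toLex a < toLex b ↔ ∃ i, (∀ j < i, a j = b j) ∧ a i = false ∧ b i = true := by
  change (∃ i, (∀ j, j < i → a j = b j) ∧ a i < b i) ↔ _
  simp only [Bool.lt_iff]

/-- The word read from position `j` on, complemented if it starts with `1`. -/
def relWord (b : ℕ → Bool) (j : ℕ) : ℕ → Bool := fun k => xor (b j) (b (j + k))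

/-- `b` is antiperiodic with antiperiod `m`. -/
def IsAnti (m : ℕ) (b : ℕ → Bool) : Prop := ∀ k, b (k + m) = !b k

/-- An antiperiodic word that is the largest of its normalised shifts. -/
structure IsTopWord (m : ℕ) (b : ℕ → Bool) : Prop where
  anti : IsAnti m b
  zero : b 0 = false
  le : ∀ j, toLex (relWord b j) ≤ toLex b

/-- The Thue-Morse substitution `0 ↦ 01`, `1 ↦ 10`. -/
def mu (c : ℕ → Bool) : ℕ → Bool := fun k => xor (c (k / 2)) (decide (k % 2 = 1))

theorem mu_even (c : ℕ → Bool) (i : ℕ) : mu c (2 * i) = c i := by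
  simp [mu]

theorem mu_odd (c : ℕ → Bool) (i : ℕ) : mu c (2 * i + 1) = !c i := by
  have h1 : (2 * i + 1) / 2 = i := by omega
  have h2 : (2 * i + 1) % 2 = 1 := by omega
  simp [mu, h1, h2]

theorem mu_lt_mu {c c' : ℕ → Bool} (h : toLex c < toLex c') : toLex (mu c) < toLex (mu c') := by
  rw [toLex_lt_iff] at h ⊢
  obtain ⟨i, h1, h2, h3⟩ := h
  refine ⟨2 * i, fun j hj => ?_, by rw [mu_even, h2], by rw [mu_even, h3]⟩
  simp only [mu, h1 (j / 2) (by omega)]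

theorem mu_le_mu {c c' : ℕ → Bool} : toLex (mu c) ≤ toLex (mu c') ↔ toLex c ≤ toLex c' := by
  constructor
  · intro h
    by_contra hc
    exact absurd (mu_lt_mu (not_le.mp hc)) (not_lt.mpr h)
  · intro h
    rcases h.eq_or_lt with h | h
    · rw [show c = c' from h]
    · exact (mu_lt_mu h).le

theorem mu_anti {m : ℕ} {c : ℕ → Bool} (h : IsAnti m c) : IsAnti (2 * m) (mu c) := by
  intro k
  have h1 : (k + 2 * m) / 2 = k / 2 + m := by omega
  have h2 : (k + 2 * m) % 2 = k % 2 := by omega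
  simp only [mu, h1, h2, h (k / 2)]
  simp

theorem relWord_mu_even (c : ℕ → Bool) (j : ℕ) : relWord (mu c) (2 * j) = mu (relWord c j) := by
  funext k
  have h1 : (2 * j + k) / 2 = j + k / 2 := by omega
  have h2 : (2 * j + k) % 2 = k % 2 := by omega
  simp only [relWord, mu_even]
  simp only [mu, h1, h2, relWord, Bool.xor_assoc]

theorem anti_eq {m : ℕ} (hm : 0 < m) {b b' : ℕ → Bool} (h : IsAnti m b) (h' : IsAnti m b')
    (e : ∀ k < m, b k = b' k) : b = b' := by
  funext k
  induction k using Nat.strong_induction_on with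
  | _ k ih =>
    rcases lt_or_ge k m with hk | hk
    · exact e k hk
    · obtain ⟨i, rfl⟩ := Nat.exists_eq_add_of_le' hk
      rw [h, h', ih i (by omega)]

theorem IsAnti.two_mul {m : ℕ} {b : ℕ → Bool} (h : IsAnti m b) (k : ℕ) :
    b (k + 2 * m) = b k := by
  rw [_root_.two_mul, ← add_assoc, h, h, Bool.not_not]

theorem IsAnti.mul_period {m : ℕ} {b : ℕ → Bool} (h : IsAnti m b) (k t : ℕ) :
    b (k + t * (2 * m)) = b k := by
  induction t with
  | zero => simp
  | succ t ih => rw [add_mul, one_mul, ← add_assoc, h.two_mul, ih]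

/-- Some position is followed by a change. -/
theorem IsAnti.exists_change {m : ℕ} {b : ℕ → Bool} (h : IsAnti m b) :
    ∃ j, b (j + 1) = !b j := by
  by_contra! hc
  have : ∀ k, b k = b 0 := by
    intro k
    induction k with
    | zero => rfl
    | succ k ih => rw [← ih]; have := hc k; revert this; cases b (k + 1) <;> cases b k <;> simp
  have h0 := h 0
  rw [this (0 + m)] at h0
  revert h0; cases b 0 <;> simp

/-- Antiperiodicity forces a change somewhere; the normalised shift read from there starts with 01,
and b must be at least as large. -/
theorem IsTopWord.one {m : ℕ} {b : ℕ → Bool} (h : IsTopWord m b) : b 1 = true := by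
  obtain ⟨j, hj⟩ := h.anti.exists_change
  have := Pi.apply_le_of_toLex (i := 1) (h.le j) (by
    intro i hi
    obtain rfl : i = 0 := by omega
    simp [relWord, h.zero])
  simp only [relWord, hj] at this
  revert this; cases b j <;> cases b 1 <;> simp

/-- Either the word alternates, or some change is followed by a repetition. -/
theorem alternating_or {b : ℕ → Bool} (h0 : b 0 = false) (h1 : b 1 = true) :
    (b = fun k => decide (k % 2 = 1)) ∨ ∃ j, b (j + 1) = (!b j) ∧ b (j + 2) = b (j + 1) := by
  by_cases h : ∃ j, b (j + 1) = (!b j) ∧ b (j + 2) = b (j + 1)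
  · exact Or.inr h
  · left
    push Not at h
    have key : ∀ k, b (k + 1) = !b k := by
      intro k
      induction k with
      | zero => simp [h0, h1]
      | succ k ih =>
        have := h k ih
        revert this; cases b (k + 1 + 1) <;> cases b (k + 1) <;> simp
    funext k
    induction k with
    | zero => simp [h0]
    | succ k ih =>
      rw [key, ih]
      rcases Nat.mod_two_eq_zero_or_one k with hk | hk <;> simp [hk, Nat.add_mod]

theorem not_anti_alternating {m : ℕ} :
    ¬ IsAnti (2 * m) (fun k => decide (k % 2 = 1)) := by
  intro h
  have := h 0
  simp at this

theorem IsTopWord.two_of_exists {m : ℕ} {b : ℕ → Bool} (h : IsTopWord m b)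
    (hj : ∃ j, b (j + 1) = (!b j) ∧ b (j + 2) = b (j + 1)) : b 2 = true := by
  obtain ⟨j, hj1, hj2⟩ := hj
  have := Pi.apply_le_of_toLex (i := 2) (h.le j) (by
    intro i hi
    have := h.one
    interval_cases i <;> simp [relWord, h.zero, hj1, this])
  simp only [relWord, hj2, hj1] at this
  revert this; cases b j <;> cases b 2 <;> simp

/-- The largest image under `mu` of a word starting with `0`. -/
def muMax : ℕ → Bool := mu (fun k => decide (k ≠ 0))

theorem muMax_even (i : ℕ) : muMax (2 * i) = decide (i ≠ 0) := by
  rw [muMax, mu_even]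

theorem muMax_odd (i : ℕ) : muMax (2 * i + 1) = decide (i = 0) := by
  rw [muMax, mu_odd]; simp

theorem mu_le_muMax {c : ℕ → Bool} (h : c 0 = false) : toLex (mu c) ≤ toLex muMax := by
  rw [muMax, mu_le_mu]
  apply Pi.toLex_monotone
  intro i
  rcases Nat.eq_zero_or_pos i with rfl | hi
  · simp [h]
  · simp [hi.ne', Bool.le_true]

/-- A word all of whose normalised shifts are at most `muMax` is a concatenation of the blocks
`01` and `10` from any change on that is followed by a repetition. -/
theorem change_of_le_muMax {b : ℕ → Bool} (hb : ∀ j, toLex (relWord b j) ≤ toLex muMax) {j : ℕ}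
    (h1 : b (j + 1) = !b j) (h2 : b (j + 2) = b (j + 1)) (i : ℕ) :
    b (j + 2 * i + 1) = !b (j + 2 * i) := by
  -- Block s is where the current match with `muMax` = 01 10 10 10 … began; the match reaches at
  -- least one letter past block i.
  have inv : ∀ i, ∃ s ≤ i, ∀ k ≤ 2 * (i - s) + 2, relWord b (j + 2 * s) k = muMax k := by
    intro i
    induction i with
    | zero =>
      refine ⟨0, le_rfl, fun k hk => ?_⟩
      have hk : k ≤ 2 := by simpa using hk
      interval_cases k <;> simp [relWord, muMax, mu, h1, h2]
    | succ i ih =>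
      obtain ⟨s, hs, hk⟩ := ih
      obtain ⟨r, rfl⟩ := Nat.exists_eq_add_of_le hs
      have e1 : s + r - s = r := by omega
      rw [e1] at hk
      have odd : relWord b (j + 2 * s) (2 * r + 3) = false := by
        have := Pi.apply_le_of_toLex (i := 2 * r + 3) (hb (j + 2 * s))
          (fun k h => hk k (by omega))
        rw [show 2 * r + 3 = 2 * (r + 1) + 1 by ring, muMax_odd] at this
        rw [show 2 * r + 3 = 2 * (r + 1) + 1 by ring]
        simpa [Bool.le_iff_imp] using this
      by_cases hx : relWord b (j + 2 * s) (2 * r + 4) = true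
      · refine ⟨s, by omega, fun k hkk => ?_⟩
        have e2 : s + r + 1 - s = r + 1 := by omega
        rw [e2] at hkk
        rcases Nat.lt_or_ge k (2 * r + 3) with h | h
        · exact hk k (by omega)
        · obtain rfl | rfl : k = 2 * (r + 1) + 1 ∨ k = 2 * (r + 2) := by omega
          · rw [muMax_odd, show 2 * (r + 1) + 1 = 2 * r + 3 by ring, odd]; simp
          · rw [muMax_even, show 2 * (r + 2) = 2 * r + 4 by ring, hx]; simp
      -- The match breaks with letters 1, 0, 0 (up to normalisation): again a change followed by a
      -- repetition, so a new match starts at this block.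
      · refine ⟨s + r + 1, le_rfl, fun k hkk => ?_⟩
        have hkk : k ≤ 2 := by simpa using hkk
        have ev := hk (2 * r + 2) le_rfl
        rw [show 2 * r + 2 = 2 * (r + 1) by ring, muMax_even] at ev
        simp only [Bool.not_eq_true] at hx
        simp only [relWord] at odd hx ev ⊢
        rw [show j + 2 * s + 2 * (r + 1) = j + 2 * (s + r + 1) by ring] at ev
        rw [show j + 2 * s + (2 * r + 3) = j + 2 * (s + r + 1) + 1 by ring] at odd
        rw [show j + 2 * s + (2 * r + 4) = j + 2 * (s + r + 1) + 2 by ring] at hx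
        revert ev odd hx
        interval_cases k <;> simp [muMax, mu] <;>
        cases b (j + 2 * s) <;> cases b (j + 2 * (s + r + 1)) <;>
        simp +contextual
  obtain ⟨s, hs, hk⟩ := inv i
  obtain ⟨r, rfl⟩ := Nat.exists_eq_add_of_le hs
  have a1 := hk (2 * r) (by omega)
  have a2 := hk (2 * r + 1) (by omega)
  rw [muMax_even] at a1
  rw [muMax_odd] at a2
  simp only [relWord] at a1 a2
  rw [show j + 2 * (s + r) + 1 = j + 2 * s + (2 * r + 1) by ring,
    show j + 2 * (s + r) = j + 2 * s + 2 * r by ring]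
  revert a1 a2
  by_cases hr : r = 0 <;> simp [hr] <;> cases b (j + 2 * s) <;> simp +contextual

/-- The words `e₁ < e₂ < e₃` are the three smallest words that are `m`-antiperiodic and the largest
of their normalised shifts. -/
structure FirstThree (m : ℕ) (e₁ e₂ e₃ : ℕ → Bool) : Prop where
  top₁ : IsTopWord m e₁
  top₂ : IsTopWord m e₂
  top₃ : IsTopWord m e₃
  lt₁₂ : toLex e₁ < toLex e₂
  lt₂₃ : toLex e₂ < toLex e₃
  eq_of_le : ∀ b, IsTopWord m b → toLex b ≤ toLex e₃ → b = e₁ ∨ b = e₂ ∨ b = e₃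

/-- An odd shift reads across the blocks: normalised, it starts with 010 if the two neighbouring
letters of c agree and with 00 if they differ, while `mu c` starts with 011. -/
theorem IsTopWord.relWord_mu_odd_lt {m : ℕ} {c : ℕ → Bool} (h : IsTopWord m c) (i : ℕ) :
    toLex (relWord (mu c) (2 * i + 1)) < toLex (mu c) := by
  apply toLex_lt_iff.mpr
  have h0 := h.zero
  have h1 := h.one
  have o1 := mu_odd c i
  have o2 := mu_even c (i + 1)
  have o3 := mu_odd c (i + 1)
  have m1 := mu_odd c 0
  have m2 := mu_even c 1
  simp only [Nat.mul_zero, Nat.zero_add, Nat.mul_one] at m1 m2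
  rw [show 2 * (i + 1) = 2 * i + 1 + 1 by ring] at o2 o3
  by_cases hc : c (i + 1) = c i
  · refine ⟨2, fun k hk => ?_, ?_, ?_⟩
    · interval_cases k
      · simp [relWord, mu, h0]
      · simp only [relWord, o1, o2, hc, m1, h0]; cases c i <;> simp
    · simp only [relWord, o1]
      rw [show 2 * i + 1 + 2 = 2 * i + 1 + 1 + 1 by ring, o3, hc]; cases c i <;> simp
    · rw [m2, h1]
  · refine ⟨1, fun k hk => ?_, ?_, ?_⟩
    · interval_cases k
      simp [relWord, mu, h0]
    · simp only [relWord, o1, o2]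
      revert hc; cases c i <;> cases c (i + 1) <;> simp
    · rw [m1, h0]; simp

theorem IsTopWord.map_mu {m : ℕ} {c : ℕ → Bool} (h : IsTopWord m c) : IsTopWord (2 * m) (mu c) where
  anti := mu_anti h.anti
  zero := by simp [mu, h.zero]
  le := by
    intro j
    obtain ⟨i, rfl | rfl⟩ : ∃ i, j = 2 * i ∨ j = 2 * i + 1 := ⟨j / 2, by omega⟩
    · rw [relWord_mu_even, mu_le_mu]; exact h.le i
    · exact (h.relWord_mu_odd_lt i).le

/-- An even antiperiod excludes the alternating word, so b starts with 011. Then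
`change_of_le_muMax` at position 0 cuts b into blocks 01 and 10, and comparisons of even shifts
descend to the preimage. -/
theorem IsTopWord.exists_mu {m : ℕ} {b : ℕ → Bool} (h : IsTopWord (2 * m) b)
    (hb : toLex b ≤ toLex muMax) : ∃ c, IsTopWord m c ∧ b = mu c := by
  have hj : ∃ j, b (j + 1) = (!b j) ∧ b (j + 2) = b (j + 1) := by
    rcases alternating_or h.zero h.one with h' | h'
    · have := h.anti
      rw [h'] at this
      exact absurd this not_anti_alternating
    · exact h'
  have h2 := h.two_of_exists hj
  have key := change_of_le_muMax (j := 0) (fun j => (h.le j).trans hb) (by simp [h.zero, h.one])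
    (by simp [h.one, h2])
  simp only [Nat.zero_add] at key
  have hbc : b = mu (fun i => b (2 * i)) := by
    funext k
    obtain ⟨i, rfl | rfl⟩ : ∃ i, k = 2 * i ∨ k = 2 * i + 1 := ⟨k / 2, by omega⟩
    · rw [mu_even]
    · rw [mu_odd, key]
  refine ⟨fun i => b (2 * i), ⟨fun k => ?_, h.zero, fun j => ?_⟩, hbc⟩
  · simpa [mul_add] using h.anti (2 * k)
  · rw [← mu_le_mu, ← relWord_mu_even, ← hbc]
    exact h.le _

/-- Every competitor is at most the image of e₃, hence at most `muMax`, and so has a preimage to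
which minimality applies. -/
theorem FirstThree.map_mu {m : ℕ} {e₁ e₂ e₃ : ℕ → Bool} (h : FirstThree m e₁ e₂ e₃) :
    FirstThree (2 * m) (mu e₁) (mu e₂) (mu e₃) where
  top₁ := h.top₁.map_mu
  top₂ := h.top₂.map_mu
  top₃ := h.top₃.map_mu
  lt₁₂ := mu_lt_mu h.lt₁₂
  lt₂₃ := mu_lt_mu h.lt₂₃
  eq_of_le := by
    intro b hb hle
    obtain ⟨c, hc, rfl⟩ := hb.exists_mu (hle.trans (mu_le_muMax h.top₃.zero))
    rcases h.eq_of_le c hc (mu_le_mu.mp hle) with rfl | rfl | rfl <;> simp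

/-! ### The smallest top words of odd antiperiod -/

theorem relWord_iff {b : ℕ → Bool} {j k : ℕ} :
    relWord b j k = true ↔ ¬ (b j = true ↔ b (j + k) = true) := by
  simp only [relWord]
  cases b j <;> cases b (j + k) <;> simp

theorem toLex_lt_of_iff {a b : ℕ → Bool} (i : ℕ) (h : ∀ j < i, (a j = true ↔ b j = true))
    (ha : ¬ a i = true) (hb : b i = true) : toLex a < toLex b :=
  toLex_lt_iff.mpr ⟨i, fun j hj => Bool.eq_iff_iff.mpr (h j hj), by simpa using ha, hb⟩

theorem relWord_add_anti {m : ℕ} {b : ℕ → Bool} (h : IsAnti m b) (j : ℕ) :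
    relWord b (j + m) = relWord b j := by
  funext k
  simp only [relWord, h j]
  rw [show j + m + k = j + k + m by ring, h]
  simp

/-- To be a top word only has to be checked within one antiperiod. -/
theorem IsTopWord.of_lt {m : ℕ} (hm : 0 < m) {b : ℕ → Bool} (h : IsAnti m b) (h0 : b 0 = false)
    (hl : ∀ j, 0 < j → j < m → toLex (relWord b j) ≤ toLex b) : IsTopWord m b where
  anti := h
  zero := h0
  le := by
    intro j
    induction j using Nat.strong_induction_on with
    | _ j ih =>
      rcases lt_or_ge j m with hj | hj
      · rcases Nat.eq_zero_or_pos j with rfl | hp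
        · apply le_of_eq
          congr 1
          funext k
          simp [relWord, h0]
        · exact hl j hp hj
      · obtain ⟨i, rfl⟩ := Nat.exists_eq_add_of_le' hj
        rw [relWord_add_anti h]
        exact ih i (by omega)

/-- An antiperiodic word that is larger than its other normalised shifts. -/
structure IsStrictTopWord (m : ℕ) (b : ℕ → Bool) : Prop where
  anti : IsAnti m b
  zero : b 0 = false
  lt : ∀ j, 0 < j → j < m → toLex (relWord b j) < toLex b

theorem IsStrictTopWord.isTopWord {m : ℕ} (hm : 0 < m) {b : ℕ → Bool} (h : IsStrictTopWord m b) :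
    IsTopWord m b :=
  IsTopWord.of_lt hm h.anti h.zero fun j hj hjm => (h.lt j hj hjm).le

/-- A period not divisible by 2m would leave a remainder r whose normalised shift is b itself.
Strictness excludes this for r < m, antiperiodicity for r = m, and r > m reduces to r - m. -/
theorem IsStrictTopWord.dvd_of_period {m t : ℕ} (hm : 0 < m) {b : ℕ → Bool}
    (h : IsStrictTopWord m b) (ht : ∀ k, b (k + t) = b k) : 2 * m ∣ t := by
  have hr : ∀ k, b (k + t % (2 * m)) = b k := by
    intro k
    rw [← h.anti.mul_period _ (t / (2 * m)), add_assoc, Nat.mod_add_div', ht]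
  have hlt : t % (2 * m) < 2 * m := Nat.mod_lt _ (by omega)
  rw [Nat.dvd_iff_mod_eq_zero]
  generalize t % (2 * m) = r at hr hlt ⊢
  have hw : relWord b r = b := by
    funext k
    have h0 := hr 0
    rw [Nat.zero_add] at h0
    rw [relWord, h0, h.zero, add_comm, hr]; simp
  rcases Nat.eq_zero_or_pos r with h0 | h0
  · exact h0
  · exfalso
    rcases lt_trichotomy r m with h1 | rfl | h1
    · exact absurd (h.lt r h0 h1) (by rw [hw]; exact lt_irrefl _)
    · have := hr 0
      rw [h.anti] at this
      simp at this
    · obtain ⟨i, rfl⟩ := Nat.exists_eq_add_of_le' h1.le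
      rw [relWord_add_anti h.anti] at hw
      exact absurd (h.lt i (by omega) (by omega)) (by rw [hw]; exact lt_irrefl _)

theorem IsStrictTopWord.map_mu {m : ℕ} (hm : 0 < m) {c : ℕ → Bool} (h : IsStrictTopWord m c) :
    IsStrictTopWord (2 * m) (mu c) where
  anti := mu_anti h.anti
  zero := by simp [mu, h.zero]
  lt := by
    intro j hj hjm
    obtain ⟨i, rfl | rfl⟩ : ∃ i, j = 2 * i ∨ j = 2 * i + 1 := ⟨j / 2, by omega⟩
    · rw [relWord_mu_even]
      exact mu_lt_mu (h.lt i (by omega) (by omega))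
    · exact (h.isTopWord hm).relWord_mu_odd_lt i

/-- The `p`-antiperiodic word that starts with the first `p` letters of `w`. -/
def antiExt (p : ℕ) (w : ℕ → Bool) : ℕ → Bool := fun k => xor (w (k % p)) (decide (k / p % 2 = 1))

theorem antiExt_of_lt {p k : ℕ} (w : ℕ → Bool) (h : k < p) : antiExt p w k = w k := by
  simp [antiExt, Nat.mod_eq_of_lt h, Nat.div_eq_of_lt h]

theorem antiExt_anti {p : ℕ} (hp : 0 < p) (w : ℕ → Bool) : IsAnti p (antiExt p w) := by
  intro k
  simp only [antiExt, Nat.add_mod_right, Nat.add_div_right k hp]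
  rcases Nat.mod_two_eq_zero_or_one (k / p) with h | h <;> simp [h, Nat.add_mod]

theorem IsAnti.apply_of_ge {p k : ℕ} {b : ℕ → Bool} (h : IsAnti p b) (hk : p ≤ k) :
    b k = true ↔ ¬ b (k - p) = true := by
  have := h (k - p)
  rw [Nat.sub_add_cancel hk] at this
  rw [this]; simp

theorem muMax_iff {k : ℕ} : muMax k = true ↔ k = 1 ∨ (k % 2 = 0 ∧ k ≠ 0) := by
  obtain ⟨i, rfl | rfl⟩ : ∃ i, k = 2 * i ∨ k = 2 * i + 1 := ⟨k / 2, by omega⟩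
  · rw [muMax_even, decide_eq_true_iff]; omega
  · rw [muMax_odd, decide_eq_true_iff]; omega

/-- The word `010101…`. -/
def altWord : ℕ → Bool := fun k => decide (k % 2 = 1)

/-- The `p`-antiperiodic word `011010…1`. -/
def secondWord (p : ℕ) : ℕ → Bool := antiExt p muMax

/-- The `p`-antiperiodic word `011010…110`. -/
def thirdWord (p : ℕ) : ℕ → Bool :=
  antiExt p fun k => if k < p - 2 then muMax k else decide (k = p - 2)

theorem altWord_isStrictTopWord : IsStrictTopWord 1 altWord where
  anti := fun k => by
    rcases Nat.mod_two_eq_zero_or_one k with h | h <;> simp [altWord, h, Nat.add_mod]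
  zero := rfl
  lt := by omega

theorem altWord_isTopWord {p : ℕ} (hp : p % 2 = 1) : IsTopWord p altWord := by
  refine IsTopWord.of_lt (by omega) (fun k => ?_) rfl fun j _ _ => le_of_eq ?_
  · rw [Bool.eq_iff_iff]
    simp only [altWord, decide_eq_true_iff, Bool.not_eq_true', decide_eq_false_iff_not]
    omega
  · congr 1
    funext k
    rw [Bool.eq_iff_iff, relWord_iff]
    simp only [altWord, decide_eq_true_iff]
    omega

theorem secondWord_iff {p k : ℕ} (hk : k < 2 * p) :
    secondWord p k = true ↔ (k < p ∧ (k = 1 ∨ (k % 2 = 0 ∧ k ≠ 0))) ∨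
      (p ≤ k ∧ ¬ (k - p = 1 ∨ ((k - p) % 2 = 0 ∧ k - p ≠ 0))) := by
  rcases lt_or_ge k p with h | h
  · rw [secondWord, antiExt_of_lt _ h, muMax_iff]; omega
  · rw [secondWord, (antiExt_anti (by omega) _).apply_of_ge h, antiExt_of_lt _ (by omega),
      muMax_iff]
    omega

theorem thirdWord_iff {p k : ℕ} (hk : k < 2 * p) :
    thirdWord p k = true ↔
      (k < p ∧ ((k < p - 2 ∧ (k = 1 ∨ (k % 2 = 0 ∧ k ≠ 0))) ∨ k = p - 2)) ∨
      (p ≤ k ∧ ¬ ((k - p < p - 2 ∧ (k - p = 1 ∨ ((k - p) % 2 = 0 ∧ k - p ≠ 0))) ∨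
        k - p = p - 2)) := by
  have aux : ∀ i, (if i < p - 2 then muMax i else decide (i = p - 2)) = true ↔
      (i < p - 2 ∧ (i = 1 ∨ (i % 2 = 0 ∧ i ≠ 0))) ∨ i = p - 2 := by
    intro i
    split_ifs with hi
    · rw [muMax_iff]; omega
    · rw [decide_eq_true_iff]; omega
  rcases lt_or_ge k p with h | h
  · rw [thirdWord, antiExt_of_lt _ h, aux]; omega
  · rw [thirdWord, (antiExt_anti (by omega) _).apply_of_ge h, antiExt_of_lt _ (by omega), aux]
    omega

theorem secondWord_isStrictTopWord {p : ℕ} (hp : p % 2 = 1) (h3 : 3 ≤ p) :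
    IsStrictTopWord p (secondWord p) := by
  refine ⟨antiExt_anti (by omega) _, ?_, fun j hj0 hj => ?_⟩
  · rw [← Bool.not_eq_true, secondWord_iff (by omega)]; omega
  -- The cases are grouped by the place where the shift first falls below the word: the shifted
  -- words start with 00, 00, 010 and 01100, against 01101….
  · have key : j = 1 ∨ j = p - 1 ∨ (2 ≤ j ∧ j + 3 ≤ p) ∨ (5 ≤ p ∧ j = p - 2) := by omega
    rcases key with h | h | h | h
    · refine toLex_lt_of_iff 1 (fun k hk => ?_) ?_ ?_ <;>
      (try simp only [relWord_iff]) <;> repeat rw [secondWord_iff (by omega)]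
      all_goals omega
    · refine toLex_lt_of_iff 1 (fun k hk => ?_) ?_ ?_ <;>
      (try simp only [relWord_iff]) <;> repeat rw [secondWord_iff (by omega)]
      all_goals omega
    · refine toLex_lt_of_iff 2 (fun k hk => ?_) ?_ ?_ <;>
      (try simp only [relWord_iff]) <;> repeat rw [secondWord_iff (by omega)]
      all_goals omega
    · refine toLex_lt_of_iff 4 (fun k hk => ?_) ?_ ?_ <;>
      (try simp only [relWord_iff]) <;> repeat rw [secondWord_iff (by omega)]
      all_goals omega

theorem thirdWord_isStrictTopWord {p : ℕ} (hp : p % 2 = 1) (h5 : 5 ≤ p) :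
    IsStrictTopWord p (thirdWord p) := by
  refine ⟨antiExt_anti (by omega) _, ?_, fun j hj0 hj => ?_⟩
  · rw [← Bool.not_eq_true, thirdWord_iff (by omega)]; omega
  -- Here i is the place where the shift by j first falls below the word. The shift p - 4 starts
  -- with 0110100; for p = 7 the word is already larger at index 5, for p ≥ 9 only at index 6.
  · have key : ∃ i, (i = 1 ∧ (j = 1 ∨ j = p - 3)) ∨
        (i = 2 ∧ (2 ≤ j ∧ j + 5 ≤ p ∨ j = p - 2 ∨ j = p - 1)) ∨
        (i = 5 ∧ 2 ≤ j ∧ p = 7 ∧ j = p - 4) ∨ (i = 6 ∧ 9 ≤ p ∧ j = p - 4) := by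
      have : j = 1 ∨ j = p - 3 ∨ (2 ≤ j ∧ j + 5 ≤ p) ∨ j = p - 2 ∨ j = p - 1 ∨
        (2 ≤ j ∧ p = 7 ∧ j = p - 4) ∨ (9 ≤ p ∧ j = p - 4) := by omega
      rcases this with h | h | h | h | h | h | h
      exacts [⟨1, by omega⟩, ⟨1, by omega⟩, ⟨2, by omega⟩, ⟨2, by omega⟩, ⟨2, by omega⟩,
        ⟨5, by omega⟩, ⟨6, by omega⟩]
    obtain ⟨i, h⟩ := key
    rcases h with h | h | h | h
    all_goals
      refine toLex_lt_of_iff i (fun k hk => ?_) ?_ ?_ <;>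
      (try simp only [relWord_iff]) <;> repeat rw [thirdWord_iff (by omega)]
    all_goals omega

/-- Otherwise b would split into blocks 01 and 10 from 0 on. For odd p the pair at 1 + p, 2 + p is
such a block, but by antiperiodicity it is the complement of b 1 = b 2. -/
theorem IsTopWord.muMax_lt {p : ℕ} (hp : p % 2 = 1) {b : ℕ → Bool} (h : IsTopWord p b)
    (hb : b ≠ altWord) : (b 2 = true) ∧ toLex muMax < toLex b := by
  have h2 := h.two_of_exists ((alternating_or h.zero h.one).resolve_left hb)
  refine ⟨h2, ?_⟩
  by_contra hc
  have key := change_of_le_muMax (j := 0) (fun j => (h.le j).trans (not_lt.mp hc))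
    (by simp [h.zero, h.one]) (by simp [h.one, h2])
  simp only [Nat.zero_add] at key
  have k1 := key ((1 + p) / 2)
  rw [show 2 * ((1 + p) / 2) = 1 + p by omega, h.anti, show 1 + p + 1 = 2 + p by ring, h.anti] at k1
  simp [h.one, h2] at k1

/-- A non-alternating b exceeds `muMax`, so only the first difference matters. Before p - 2 it makes
b too large; at p - 2 it forces the last letter to be 0; p - 1 is impossible because `muMax` has a 1
there; from p on, b is `secondWord`. -/
theorem eq_of_le_thirdWord {p : ℕ} (hp : p % 2 = 1) (h5 : 5 ≤ p) {b : ℕ → Bool}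
    (h : IsTopWord p b) (hb : toLex b ≤ toLex (thirdWord p)) :
    b = altWord ∨ b = secondWord p ∨ b = thirdWord p := by
  by_cases ha : b = altWord
  · exact Or.inl ha
  right
  obtain ⟨h2, hlt⟩ := h.muMax_lt hp ha
  obtain ⟨i, hi1, hi2, hi3⟩ := toLex_lt_iff.mp hlt
  have hi2' := mt muMax_iff.mpr (by simpa using hi2)
  have hi0 : i ≠ 0 := by
    rintro rfl
    simp [h.zero] at hi3
  rcases lt_or_ge i (p - 2) with hip | hip
  · exfalso
    refine absurd hb (not_le.mpr (toLex_lt_of_iff i (fun k hk => ?_) ?_ hi3))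
    · rw [← hi1 k hk, thirdWord_iff (by omega), muMax_iff]; omega
    · rw [thirdWord_iff (by omega)]; omega
  · rcases lt_or_ge i p with hip' | hip'
    · obtain rfl : i = p - 2 := by omega
      right
      have hlast : b (p - 1) = false := by
        by_contra hc
        refine absurd hb (not_le.mpr
          (toLex_lt_of_iff (p - 1) (fun k hk => ?_) ?_ (by simpa using hc)))
        · rcases lt_or_ge k (p - 2) with hk' | hk'
          · rw [← hi1 k hk', thirdWord_iff (by omega), muMax_iff]; omega
          · obtain rfl : k = p - 2 := by omega
            rw [thirdWord_iff (by omega)]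
            exact iff_of_true (by omega) hi3
        · rw [thirdWord_iff (by omega)]; omega
      refine anti_eq (by omega) h.anti (antiExt_anti (by omega) _) fun k hk => ?_
      rw [Bool.eq_iff_iff, thirdWord_iff (by omega)]
      have : k < p - 2 ∨ k = p - 2 ∨ k = p - 1 := by omega
      rcases this with hk' | rfl | rfl
      · rw [← hi1 k hk', muMax_iff]; omega
      · exact iff_of_true hi3 (by omega)
      · exact iff_of_false (by simp [hlast]) (by omega)
    · left
      refine anti_eq (by omega) h.anti (antiExt_anti (by omega) _) fun k hk => ?_
      rw [secondWord, antiExt_of_lt _ hk, hi1 k (by omega)]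

theorem firstThree_of_odd {p : ℕ} (hp : p % 2 = 1) (h5 : 5 ≤ p) :
    FirstThree p altWord (secondWord p) (thirdWord p) where
  top₁ := altWord_isTopWord hp
  top₂ := (secondWord_isStrictTopWord hp (by omega)).isTopWord (by omega)
  top₃ := (thirdWord_isStrictTopWord hp h5).isTopWord (by omega)
  lt₁₂ := by
    refine toLex_lt_of_iff 2 (fun k hk => ?_) ?_ ?_
    · rw [secondWord_iff (by omega), altWord, decide_eq_true_iff]; omega
    · simp [altWord]
    · rw [secondWord_iff (by omega)]; omega
  lt₂₃ := by
    refine toLex_lt_of_iff (p - 2) (fun k hk => ?_) ?_ ?_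
    · rw [secondWord_iff (by omega), thirdWord_iff (by omega)]; omega
    · rw [secondWord_iff (by omega)]; omega
    · rw [thirdWord_iff (by omega)]; omega
  eq_of_le := fun _ h hb => eq_of_le_thirdWord hp h5 h hb

/-- The `6`-antiperiodic word `011100`. -/
def sixWord : ℕ → Bool := antiExt 6 fun k => decide (k = 1 ∨ k = 2 ∨ k = 3)

theorem sixWord_iff {k : ℕ} (hk : k < 12) :
    sixWord k = true ↔ k = 1 ∨ k = 2 ∨ k = 3 ∨ k = 6 ∨ k = 10 ∨ k = 11 := by
  interval_cases k <;> decide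

theorem sixWord_isStrictTopWord : IsStrictTopWord 6 sixWord := by
  refine ⟨antiExt_anti (by omega) _, rfl, fun j hj0 hj => ?_⟩
  have key : ∃ i, (i = 1 ∧ (j = 1 ∨ j = 2 ∨ j = 4)) ∨ (i = 3 ∧ j = 3) ∨ (i = 2 ∧ j = 5) := by
    have : j = 1 ∨ j = 2 ∨ j = 4 ∨ j = 3 ∨ j = 5 := by omega
    rcases this with h | h | h | h | h
    exacts [⟨1, by omega⟩, ⟨1, by omega⟩, ⟨1, by omega⟩, ⟨3, by omega⟩, ⟨2, by omega⟩]
  obtain ⟨i, h⟩ := key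
  rcases h with h | h | h
  all_goals
    refine toLex_lt_of_iff i (fun k hk => ?_) ?_ ?_ <;>
    (try simp only [relWord_iff]) <;> repeat rw [sixWord_iff (by omega)]
  all_goals omega

theorem IsTopWord.relWord_le {m : ℕ} {b : ℕ → Bool} (h : IsTopWord m b) (j i : ℕ)
    (hp : ∀ k < i, relWord b j k = b k) : relWord b j i = true → b i = true := by
  have := Pi.apply_le_of_toLex (i := i) (h.le j) hp
  exact Bool.le_iff_imp.mp this

/-- The word starts with 011. The endings 000 and 011 are excluded because the shifts by 2 and 3
would start with 0111, and after 0111 the upper bound forces 00. -/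
theorem eq_of_le_sixWord {b : ℕ → Bool} (h : IsTopWord 6 b) (hb : toLex b ≤ toLex sixWord) :
    b = mu altWord ∨ b = mu (secondWord 3) ∨ b = sixWord := by
  have hj : ∃ j, b (j + 1) = (!b j) ∧ b (j + 2) = b (j + 1) := by
    rcases alternating_or h.zero h.one with h' | h'
    · have := h.anti
      rw [h'] at this
      exact absurd this (not_anti_alternating (m := 3))
    · exact h'
  have h0 := h.zero
  have h1 := h.one
  have h2 := h.two_of_exists hj
  have h6 := h.anti 0
  have a1 : IsAnti 6 (mu altWord) := mu_anti (altWord_isTopWord (p := 3) rfl).anti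
  have a2 : IsAnti 6 (mu (secondWord 3)) :=
    mu_anti (secondWord_isStrictTopWord (p := 3) rfl le_rfl).anti
  have a3 : IsAnti 6 sixWord := sixWord_isStrictTopWord.anti
  rw [Nat.zero_add, h0] at h6
  have s2 := h.relWord_le 2 3
  have s3 := h.relWord_le 3 3
  have e4 := Pi.apply_le_of_toLex (i := 4) hb
  have e5 := Pi.apply_le_of_toLex (i := 5) hb
  have v : ∀ k < 6, sixWord k = decide (k = 1 ∨ k = 2 ∨ k = 3) := by decide
  have key : (b 3 = false ∧ b 4 = false ∧ b 5 = true) ∨ (b 3 = false ∧ b 4 = true ∧ b 5 = false) ∨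
      (b 3 = true ∧ b 4 = false ∧ b 5 = false) := by
    have p4 : b 3 = true → ∀ j < 4, b j = sixWord j := by
      intro h3 j hj
      rw [v j (by omega)]
      interval_cases j <;> simp [*]
    have p5 : b 3 = true → b 4 = false → ∀ j < 5, b j = sixWord j := by
      intro h3 h4 j hj
      rw [v j (by omega)]
      interval_cases j <;> simp [*]
    simp only [relWord] at s2 s3
    cases h3 : b 3
    · cases h4 : b 4 <;> cases h5 : b 5
      · have := s2 (by intro k hk; interval_cases k <;> simp [*]) (by simp [*])
        simp [h3] at this
      · simp
      · simp
      · have := s3 (by intro k hk; interval_cases k <;> simp [*]) (by simp [*])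
        simp [h3] at this
    · cases h4 : b 4 <;> cases h5 : b 5
      · simp
      · have := e5 (p5 h3 h4)
        rw [h5, v 5 (by omega)] at this
        exact absurd this (by decide)
      · have := e4 (p4 h3)
        rw [h4, v 4 (by omega)] at this
        exact absurd this (by decide)
      · have := e4 (p4 h3)
        rw [h4, v 4 (by omega)] at this
        exact absurd this (by decide)
  rcases key with ⟨h3, h4, h5⟩ | ⟨h3, h4, h5⟩ | ⟨h3, h4, h5⟩
  · left
    refine anti_eq (by omega) h.anti a1 fun k hk => ?_
    interval_cases k <;> simp [*] <;> decide
  · right; left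
    refine anti_eq (by omega) h.anti a2 fun k hk => ?_
    interval_cases k <;> simp [*] <;> decide
  · right; right
    refine anti_eq (by omega) h.anti a3 fun k hk => ?_
    interval_cases k <;> simp [*]

/-- Antiperiod 3 has only the two top words 010 and 011, so for p = 3 the third word appears only at
antiperiod 6; it is not an image under `mu`. -/
theorem firstThree_six : FirstThree 6 (mu altWord) (mu (secondWord 3)) sixWord where
  top₁ := (altWord_isTopWord (p := 3) rfl).map_mu
  top₂ := ((secondWord_isStrictTopWord (p := 3) rfl le_rfl).isTopWord (by omega)).map_mu
  top₃ := sixWord_isStrictTopWord.isTopWord (by omega)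
  lt₁₂ := by
    refine mu_lt_mu (toLex_lt_iff.mpr ⟨2, ?_, ?_, ?_⟩) <;> decide
  lt₂₃ := by
    refine toLex_lt_iff.mpr ⟨3, ?_, ?_, ?_⟩ <;> decide
  eq_of_le := fun _ h hb => eq_of_le_sixWord h hb

/-! ### Words and coset leaders -/

/-- The first `m` letters of `b` read as a number in base `q`. -/
def wordSum (q m : ℕ) (b : ℕ → Bool) : ℤ :=
  ∑ k ∈ Finset.range m, ((b k).toNat : ℤ) * (q : ℤ) ^ (m - 1 - k)

/-- The value `N ∑ (b_k - b_{k-1}) q^{-k}` with `N = q ^ m + 1` of an `m`-antiperiodic word. -/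
def wordVal (q m : ℕ) (b : ℕ → Bool) : ℤ := ((q : ℤ) - 1) * wordSum q m b + 1

theorem wordSum_succ (q m : ℕ) (b : ℕ → Bool) :
    wordSum q (m + 1) b = ((b 0).toNat : ℤ) * (q : ℤ) ^ m + wordSum q m (fun k => b (k + 1)) := by
  rw [wordSum, Finset.sum_range_succ', add_comm]
  congr 1
  apply Finset.sum_congr rfl
  intro k hk
  congr 2
  omega

theorem wordSum_shift (q m : ℕ) (b : ℕ → Bool) :
    wordSum q m (fun k => b (k + 1)) =
      q * wordSum q m b - ((b 0).toNat : ℤ) * (q : ℤ) ^ m + ((b m).toNat : ℤ) := by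
  have h := wordSum_succ q m b
  rw [wordSum, Finset.sum_range_succ] at h
  have h2 : ∑ x ∈ Finset.range m, ((b x).toNat : ℤ) * (q : ℤ) ^ (m + 1 - 1 - x) =
      q * wordSum q m b := by
    rw [wordSum, Finset.mul_sum]
    apply Finset.sum_congr rfl
    intro k hk
    rw [Finset.mem_range] at hk
    rw [show m + 1 - 1 - k = (m - 1 - k) + 1 by omega, pow_succ]
    ring
  rw [h2] at h
  simp at h
  linarith

theorem wordVal_shift (q m : ℕ) {b : ℕ → Bool} (h : IsAnti m b) :
    wordVal q m (fun k => b (k + 1)) =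
      q * wordVal q m b - ((q : ℤ) - 1) * ((q : ℤ) ^ m + 1) * ((b 0).toNat : ℤ) := by
  have hm : ((b m).toNat : ℤ) = 1 - ((b 0).toNat : ℤ) := by
    have := h 0
    rw [Nat.zero_add] at this
    rw [this]; cases b 0 <;> simp
  rw [wordVal, wordVal, wordSum_shift, hm]
  ring

theorem wordSum_not (q m : ℕ) (b : ℕ → Bool) :
    ((q : ℤ) - 1) * (wordSum q m b + wordSum q m (fun k => !b k)) = (q : ℤ) ^ m - 1 := by
  induction m generalizing b with
  | zero => simp [wordSum]
  | succ m ih =>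
    rw [wordSum_succ, wordSum_succ]
    have := ih (fun k => b (k + 1))
    rw [pow_succ]
    cases b 0 <;> simp <;> linear_combination this

theorem wordVal_not (q m : ℕ) (b : ℕ → Bool) :
    wordVal q m (fun k => !b k) = (q : ℤ) ^ m + 1 - wordVal q m b := by
  have := wordSum_not q m b
  rw [wordVal, wordVal]
  linear_combination this

theorem wordSum_nonneg (q m : ℕ) (b : ℕ → Bool) : 0 ≤ wordSum q m b :=
  Finset.sum_nonneg fun _ _ => by positivity

theorem wordSum_lt {q : ℕ} (hq : 2 ≤ q) (m : ℕ) (b : ℕ → Bool) :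
    ((q : ℤ) - 1) * wordSum q m b ≤ (q : ℤ) ^ m - 1 := by
  have h := wordSum_not q m b
  have h1 := wordSum_nonneg q m (fun k => !b k)
  have : (2 : ℤ) ≤ q := by exact_mod_cast hq
  nlinarith

theorem one_le_wordVal {q : ℕ} (hq : 2 ≤ q) (m : ℕ) (b : ℕ → Bool) : 1 ≤ wordVal q m b := by
  have h1 := wordSum_nonneg q m b
  have : (2 : ℤ) ≤ q := by exact_mod_cast hq
  rw [wordVal]
  nlinarith

theorem wordVal_le {q m : ℕ} (hq : 2 ≤ q) (hm : 0 < m) {b : ℕ → Bool} (h0 : b 0 = false) :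
    (q : ℤ) * wordVal q m b ≤ (q : ℤ) ^ m := by
  obtain ⟨m, rfl⟩ := Nat.exists_eq_add_of_le' hm
  rw [wordVal, wordSum_succ, h0, pow_succ]
  have := wordSum_lt hq m (fun k => b (k + 1))
  have : (2 : ℤ) ≤ q := by exact_mod_cast hq
  simp
  nlinarith

theorem wordSum_lt_wordSum {q : ℕ} (hq : 2 ≤ q) (i m : ℕ) (him : i < m) (b b' : ℕ → Bool)
    (h : ∀ j < i, b j = b' j) (hb : b i = false) (hb' : b' i = true) :
    wordSum q m b < wordSum q m b' := by
  induction i generalizing m b b' with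
  | zero =>
    obtain ⟨m, rfl⟩ := Nat.exists_eq_add_of_le' him
    rw [wordSum_succ, wordSum_succ, hb, hb']
    have h1 := wordSum_lt hq m (fun k => b (k + 1))
    have h2 := wordSum_nonneg q m (fun k => b' (k + 1))
    have h3 := wordSum_nonneg q m (fun k => b (k + 1))
    have : (2 : ℤ) ≤ q := by exact_mod_cast hq
    simp
    nlinarith
  | succ i ih =>
    obtain ⟨m, rfl⟩ := Nat.exists_eq_add_of_le' (Nat.zero_lt_of_lt him)
    rw [wordSum_succ, wordSum_succ, h 0 (by omega)]
    have := ih m (by omega) (fun k => b (k + 1)) (fun k => b' (k + 1))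
      (fun j hj => h (j + 1) (by omega)) hb hb'
    linarith

/-- Antiperiodic words that differ do so within the first m letters, where the lexicographic order
is the order of base-q expansions. -/
theorem wordVal_lt_wordVal {q m : ℕ} (hq : 2 ≤ q) (hm : 0 < m) {b b' : ℕ → Bool}
    (ha : IsAnti m b) (ha' : IsAnti m b') (h : toLex b < toLex b') :
    wordVal q m b < wordVal q m b' := by
  obtain ⟨i, h1, h2, h3⟩ := toLex_lt_iff.mp h
  have him : i < m := by
    by_contra hc
    have := anti_eq hm ha ha' (fun k hk => h1 k (by omega))
    simp [this, h3] at h2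
  have := wordSum_lt_wordSum hq i m him b b' h1 h2 h3
  have : (2 : ℤ) ≤ q := by exact_mod_cast hq
  rw [wordVal, wordVal]
  nlinarith

theorem toLex_le_of_wordVal_le {q m : ℕ} (hq : 2 ≤ q) (hm : 0 < m) {b b' : ℕ → Bool}
    (ha : IsAnti m b) (ha' : IsAnti m b') (h : wordVal q m b ≤ wordVal q m b') :
    toLex b ≤ toLex b' := by
  by_contra hc
  exact absurd (wordVal_lt_wordVal hq hm ha' ha (not_le.mp hc)) (not_lt.mpr h)

theorem relWord_anti {m : ℕ} {b : ℕ → Bool} (h : IsAnti m b) (j : ℕ) : IsAnti m (relWord b j) := by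
  intro k
  simp only [relWord, ← add_assoc, h (j + k)]
  simp

theorem shift_anti {m : ℕ} {b : ℕ → Bool} (h : IsAnti m b) (j : ℕ) :
    IsAnti m (fun k => b (j + k)) := by
  intro k
  simp only [← add_assoc, h (j + k)]

/-- The residue of `wordVal q m b * q ^ j` of least absolute value. -/
def signedVal (q m : ℕ) (b : ℕ → Bool) (j : ℕ) : ℤ :=
  wordVal q m (fun k => b (j + k)) - ((q : ℤ) ^ m + 1) * ((b j).toNat : ℤ)

theorem signedVal_eq (q m : ℕ) (b : ℕ → Bool) (j : ℕ) :
    signedVal q m b j = if b j then - wordVal q m (relWord b j) else wordVal q m (relWord b j) := by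
  rw [signedVal]
  cases h : b j
  · have : relWord b j = fun k => b (j + k) := by
      funext k; simp [relWord, h]
    simp [this]
  · have : relWord b j = fun k => !b (j + k) := by
      funext k; simp [relWord, h]
    rw [this, wordVal_not]
    simp

theorem signedVal_modEq (q m : ℕ) {b : ℕ → Bool} (h : IsAnti m b) (j : ℕ) :
    signedVal q m b j ≡ wordVal q m b * (q : ℤ) ^ j [ZMOD (q : ℤ) ^ m + 1] := by
  have key : ∀ j, wordVal q m (fun k => b (j + k)) ≡ wordVal q m b * (q : ℤ) ^ j
      [ZMOD (q : ℤ) ^ m + 1] := by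
    intro j
    induction j with
    | zero => simp
    | succ j ih =>
      have hs := wordVal_shift q m (shift_anti h j)
      simp only [Nat.add_zero] at hs
      rw [show (fun k => b (j + 1 + k)) = fun k => b (j + (k + 1)) by
        funext k; congr 1; ring, hs, pow_succ, ← mul_assoc, mul_comm _ (q : ℤ)]
      have h1 := ih.mul_left (q : ℤ)
      have h2 : ((q : ℤ) - 1) * ((q : ℤ) ^ m + 1) * ((b j).toNat : ℤ) ≡ 0
          [ZMOD (q : ℤ) ^ m + 1] := by
        rw [Int.modEq_zero_iff_dvd]
        exact ⟨((q : ℤ) - 1) * ((b j).toNat : ℤ), by ring⟩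
      simpa using h1.sub h2
  have h2 : ((q : ℤ) ^ m + 1) * ((b j).toNat : ℤ) ≡ 0 [ZMOD (q : ℤ) ^ m + 1] := by
    rw [Int.modEq_zero_iff_dvd]
    exact dvd_mul_right _ _
  simpa [signedVal] using (key j).sub h2

theorem mem_cosetLeaders_iff {q N s : ℕ} (hN : 0 < N) :
    s ∈ cosetLeaders q N ↔ s < N ∧ ∀ j, s ≤ s * q ^ j % N := by
  simp only [cosetLeaders, cyclotomicCoset, IsLeast, lowerBounds, Set.mem_ofPred_eq]
  constructor
  · rintro ⟨⟨j, hj⟩, h⟩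
    exact ⟨hj ▸ Nat.mod_lt _ hN, fun j => h ⟨j, rfl⟩⟩
  · rintro ⟨h1, h2⟩
    refine ⟨⟨0, by simp [Nat.mod_eq_of_lt h1]⟩, ?_⟩
    rintro x ⟨j, rfl⟩
    exact h2 j

/-- The number q^j - 1 is even, so n is fixed by multiplication by q modulo 2n. -/
theorem mul_odd_pow_modEq {q : ℕ} (hq : Odd q) (n j : ℕ) :
    (n : ℤ) * (q : ℤ) ^ j ≡ n [ZMOD 2 * n] := by
  obtain ⟨k, hk⟩ := hq.pow (n := j)
  rw [Int.modEq_iff_dvd]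
  refine ⟨-k, ?_⟩
  have : (q : ℤ) ^ j = 2 * k + 1 := by exact_mod_cast hk
  rw [this]; ring

theorem wordVal_lt_half {q m n : ℕ} (hq : 3 ≤ q) (hm : 0 < m) (hN : q ^ m + 1 = 2 * n)
    {b : ℕ → Bool} (h0 : b 0 = false) : wordVal q m b < n := by
  have h1 := wordVal_le (m := m) (by omega : 2 ≤ q) hm h0
  have h2 := one_le_wordVal (by omega : 2 ≤ q) m b
  have h3 : (q : ℤ) ^ m + 1 = 2 * n := by exact_mod_cast hN
  have h4 : (3 : ℤ) ≤ q := by exact_mod_cast hq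
  nlinarith

theorem relWord_zero (b : ℕ → Bool) (j : ℕ) : relWord b j 0 = false := by
  simp [relWord]

theorem abs_signedVal (q m : ℕ) (hq : 2 ≤ q) (b : ℕ → Bool) (j : ℕ) :
    |signedVal q m b j| = wordVal q m (relWord b j) := by
  have := one_le_wordVal hq m (relWord b j)
  rw [signedVal_eq]
  split_ifs
  · rw [abs_neg, abs_of_pos (by linarith)]
  · rw [abs_of_pos (by linarith)]

/-- The elements of the coset of the residue that belongs to a word. -/
theorem mul_pow_mod_eq {q m n s : ℕ} (hq : 3 ≤ q) (hodd : Odd q) (hm : 0 < m)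
    (hN : q ^ m + 1 = 2 * n) {b : ℕ → Bool} (h : IsAnti m b)
    (hs : (s : ℤ) = n - wordVal q m b) (j : ℕ) :
    ((s * q ^ j % (2 * n) : ℕ) : ℤ) = n - signedVal q m b j := by
  have h3 : (q : ℤ) ^ m + 1 = 2 * n := by exact_mod_cast hN
  have h1 := (mul_odd_pow_modEq hodd n j).sub (h3 ▸ (signedVal_modEq q m h j).symm)
  rw [← sub_mul, ← hs] at h1
  push_cast
  rw [h1]
  have hlt := wordVal_lt_half hq hm hN (relWord_zero b j)
  rw [← abs_signedVal q m (by omega), abs_lt] at hlt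
  exact Int.emod_eq_of_lt (by linarith) (by linarith)

theorem half_mem_cosetLeaders {q n : ℕ} (hodd : Odd q) (hn : 0 < n) :
    n ∈ cosetLeaders q (2 * n) := by
  rw [mem_cosetLeaders_iff (by omega)]
  refine ⟨by omega, fun j => ?_⟩
  have h1 := mul_odd_pow_modEq hodd n j
  have : n * q ^ j % (2 * n) = n % (2 * n) := by
    exact_mod_cast h1
  rw [this, Nat.mod_eq_of_lt (by omega)]

theorem mem_cosetLeaders_of_isTopWord {q m n s : ℕ} (hq : 3 ≤ q) (hodd : Odd q) (hm : 0 < m)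
    (hN : q ^ m + 1 = 2 * n) {b : ℕ → Bool} (h : IsTopWord m b)
    (hs : (s : ℤ) = n - wordVal q m b) : s ∈ cosetLeaders q (2 * n) := by
  have h1 := one_le_wordVal (by omega : 2 ≤ q) m b
  rw [mem_cosetLeaders_iff (by omega)]
  refine ⟨by omega, fun j => ?_⟩
  have := mul_pow_mod_eq hq hodd hm hN h.anti hs j
  have h2 : wordVal q m (relWord b j) ≤ wordVal q m b := by
    by_contra hc
    rcases (h.le j).eq_or_lt with h' | h'
    · rw [show relWord b j = b from h'] at hc
      exact hc le_rfl
    · exact hc (wordVal_lt_wordVal (by omega) hm (relWord_anti h.anti j) h.anti h').le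
  have h3 := le_abs_self (signedVal q m b j)
  rw [abs_signedVal q m (by omega)] at h3
  omega

/-- This is q^m ≡ -1 modulo 2n, the source of antiperiodicity. -/
theorem mul_pow_add_mod {q m n : ℕ} (hN : q ^ m + 1 = 2 * n) (s j : ℕ)
    (h : 0 < s * q ^ j % (2 * n)) :
    s * q ^ (j + m) % (2 * n) = 2 * n - s * q ^ j % (2 * n) := by
  have hlt : s * q ^ j % (2 * n) < 2 * n := Nat.mod_lt _ (by omega)
  have e : (s * q ^ (j + m) : ℤ) ≡ 2 * n - (s * q ^ j % (2 * n) : ℕ) [ZMOD 2 * n] := by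
    have h3 : (q : ℤ) ^ m = 2 * n - 1 := by
      have : (q : ℤ) ^ m + 1 = 2 * n := by exact_mod_cast hN
      linarith
    have h4 : (s * q ^ j : ℤ) ≡ ((s * q ^ j % (2 * n) : ℕ) : ℤ) [ZMOD 2 * n] := by
      push_cast
      exact (Int.mod_modEq _ _).symm
    have h5 : (2 * n * (s * q ^ j) : ℤ) ≡ 2 * n [ZMOD 2 * n] := by
      rw [Int.modEq_iff_dvd]; exact ⟨1 - s * q ^ j, by ring⟩
    rw [pow_add, h3]
    have := h5.sub h4
    convert this using 1
    ring
  generalize s * q ^ j % (2 * n) = x at h hlt e ⊢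
  have e2 : ((s * q ^ (j + m) % (2 * n) : ℕ) : ℤ) = 2 * n - x := by
    push_cast
    rw [e]
    apply Int.emod_eq_of_lt <;> omega
  omega

theorem cosetLeader_le_half {q m n s : ℕ} (hN : q ^ m + 1 = 2 * n)
    (hs : s ∈ cosetLeaders q (2 * n)) : s ≤ n := by
  rw [mem_cosetLeaders_iff (by omega)] at hs
  obtain ⟨h1, h2⟩ := hs
  rcases Nat.eq_zero_or_pos s with rfl | h0
  · omega
  have e : s * q ^ 0 % (2 * n) = s := by simp [Nat.mod_eq_of_lt h1]
  have := mul_pow_add_mod hN s 0 (by omega)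
  have := h2 (0 + m)
  omega

theorem mul_mod_step (q n s j : ℕ) :
    s * q ^ (j + 1) % (2 * n) = s * q ^ j % (2 * n) * q % (2 * n) := by
  rw [pow_succ, ← mul_assoc, Nat.mod_mul_mod]

/-- Every coset leader close enough to `n` modulo `2 n` belongs to a word. -/
theorem exists_isTopWord {q m n s : ℕ} (hq : 3 ≤ q) (hodd : Odd q) (hm : 0 < m)
    (hN : q ^ m + 1 = 2 * n) (hs : s ∈ cosetLeaders q (2 * n)) (hsn : s < n)
    (hlt : q * (n - s) < 2 * n) : ∃ b, IsTopWord m b ∧ (s : ℤ) = n - wordVal q m b := by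
  have hsl := hs
  rw [mem_cosetLeaders_iff (by omega)] at hs
  obtain ⟨hs1, hs2⟩ := hs
  have hs0 : 0 < s := by
    by_contra h
    obtain rfl : s = 0 := by omega
    have : 3 * n ≤ q * n := Nat.mul_le_mul_right _ hq
    simp at hlt; omega
  have hr1 : ∀ j, s * q ^ j % (2 * n) < 2 * n := fun j => Nat.mod_lt _ (by omega)
  obtain ⟨r, hr⟩ : ∃ r : ℕ → ℕ, ∀ j, r j = s * q ^ j % (2 * n) := ⟨_, fun j => rfl⟩
  have ranti : ∀ j, r (j + m) = 2 * n - r j := fun j => by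
    rw [hr, hr]
    exact mul_pow_add_mod hN s j (lt_of_lt_of_le hs0 (hs2 j))
  have r0 : r 0 = s := by rw [hr]; simp [Nat.mod_eq_of_lt hs1]
  have rge : ∀ j, s ≤ r j := fun j => by rw [hr]; exact hs2 j
  have rlt : ∀ j, r j < 2 * n := fun j => by rw [hr]; exact hr1 j
  have rle : ∀ j, r j ≤ 2 * n - s := fun j => by
    have := rge (j + m); have := ranti j; have := rlt j; omega
  have rstep : ∀ j, (r (j + 1) : ℤ) ≡ q * r j [ZMOD 2 * n] := by
    intro j
    rw [hr (j + 1), mul_mod_step, ← hr j]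
    push_cast
    rw [mul_comm (q : ℤ)]
    exact Int.mod_modEq _ _
  have rper : ∀ k j, r (j + k * (2 * m)) = r j := by
    intro k j
    induction k with
    | zero => simp
    | succ k ih =>
      rw [show j + (k + 1) * (2 * m) = j + k * (2 * m) + m + m by ring, ranti, ranti, ih]
      have := rlt j; omega
  have hqn := mul_odd_pow_modEq hodd n 1
  rw [pow_one] at hqn
  -- The residue n is fixed, so an orbit through n would stay there, whereas this one returns to s <
  -- n.
  have rne : ∀ j, r j ≠ n := by
    intro j hj
    have : ∀ i, r (j + i) = n := by
      intro i
      induction i with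
      | zero => exact hj
      | succ i ih =>
        have h1 := rstep (j + i)
        rw [ih, mul_comm (q : ℤ)] at h1
        have h2 := h1.trans hqn
        have h3 : r (j + i + 1) % (2 * n) = n % (2 * n) := by exact_mod_cast h2
        rw [Nat.mod_eq_of_lt (rlt _), Nat.mod_eq_of_lt (by omega)] at h3
        exact h3
    have h1 := this (j * (2 * m) - j)
    have h2 : j ≤ j * (2 * m) := Nat.le_mul_of_pos_right _ (by omega)
    have h3 := rper j 0
    rw [show j + (j * (2 * m) - j) = 0 + j * (2 * m) by omega, h3, r0] at h1
    omega
  let b : ℕ → Bool := fun j => decide (n < r j)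
  have hb : ∀ j, b j = true ↔ n < r j := fun j => by simp [b]
  have banti : IsAnti m b := by
    intro j
    rw [Bool.eq_iff_iff, Bool.not_eq_true', ← Bool.not_eq_true, hb, hb, ranti]
    have := rlt j; have := rne j
    omega
  have ustep : ∀ j, (n : ℤ) - r (j + 1) =
      q * (n - r j) - 2 * n * (((b (j + 1)).toNat : ℤ) - ((b j).toNat : ℤ)) := by
    intro j
    have h1 : (n : ℤ) - r (j + 1) ≡ q * (n - r j) [ZMOD 2 * n] := by
      have := hqn.symm.sub (rstep j)
      convert this using 1
      ring
    obtain ⟨a, ha⟩ := (Int.modEq_iff_dvd.mp h1)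
    -- Both q|u_j| and |u_{j+1}| are below 2n. If u_j and u_{j+1} have the same sign then |2na| <
    -- 2n; otherwise 0 < |2na| < 4n with known sign.
    have key : a = ((b (j + 1)).toNat : ℤ) - ((b j).toNat : ℤ) := by
      have hlt' : (q : ℤ) * (n - s) < 2 * n := by
        have : ((n - s : ℕ) : ℤ) = n - s := by omega
        rw [← this]; exact_mod_cast hlt
      have hq' : (0 : ℤ) < q := by omega
      have e1 := rge j; have e2 := rle j; have e3 := rne j
      have e4 := rge (j + 1); have e5 := rle (j + 1); have e6 := rne (j + 1)
      have u1 : (q : ℤ) * (n - r j) ≤ q * (n - s) := by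
        apply mul_le_mul_of_nonneg_left _ hq'.le; omega
      have u2 : (q : ℤ) * (r j - n) ≤ q * (n - s) := by
        apply mul_le_mul_of_nonneg_left _ hq'.le; omega
      have hn : (0 : ℤ) < 2 * n := by omega
      have b1 : (n : ℤ) - s ≤ q * (n - s) := by nlinarith
      cases hj : b j <;> cases hj1 : b (j + 1)
      · have h1 : ¬ n < r j := by rw [← hb, hj]; simp
        have h2 : ¬ n < r (j + 1) := by rw [← hb, hj1]; simp
        have p1 : (0 : ℤ) < q * (n - r j) := by apply mul_pos hq'; omega
        have a1 : (2 * n : ℤ) * (-1) < 2 * n * a := by rw [← ha]; omega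
        have a2 : (2 * n : ℤ) * a < 2 * n * 1 := by rw [← ha]; omega
        have := lt_of_mul_lt_mul_left a1 hn.le
        have := lt_of_mul_lt_mul_left a2 hn.le
        simp; omega
      · have h1 : ¬ n < r j := by rw [← hb, hj]; simp
        have h2 : n < r (j + 1) := by rw [← hb, hj1]
        have p1 : (0 : ℤ) < q * (n - r j) := by apply mul_pos hq'; omega
        have a1 : (2 * n : ℤ) * 0 < 2 * n * a := by rw [← ha]; omega
        have a2 : (2 * n : ℤ) * a < 2 * n * 2 := by rw [← ha]; omega
        have := lt_of_mul_lt_mul_left a1 hn.le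
        have := lt_of_mul_lt_mul_left a2 hn.le
        simp; omega
      · have h1 : n < r j := by rw [← hb, hj]
        have h2 : ¬ n < r (j + 1) := by rw [← hb, hj1]; simp
        have p1 : (0 : ℤ) < q * (r j - n) := by apply mul_pos hq'; omega
        have p2 : (q : ℤ) * (r j - n) = - (q * (n - r j)) := by ring
        have a1 : (2 * n : ℤ) * (-2) < 2 * n * a := by rw [← ha]; omega
        have a2 : (2 * n : ℤ) * a < 2 * n * 0 := by rw [← ha]; omega
        have := lt_of_mul_lt_mul_left a1 hn.le
        have := lt_of_mul_lt_mul_left a2 hn.le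
        simp; omega
      · have h1 : n < r j := by rw [← hb, hj]
        have h2 : n < r (j + 1) := by rw [← hb, hj1]
        have p1 : (0 : ℤ) < q * (r j - n) := by apply mul_pos hq'; omega
        have p2 : (q : ℤ) * (r j - n) = - (q * (n - r j)) := by ring
        have a1 : (2 * n : ℤ) * (-1) < 2 * n * a := by rw [← ha]; omega
        have a2 : (2 * n : ℤ) * a < 2 * n * 1 := by rw [← ha]; omega
        have := lt_of_mul_lt_mul_left a1 hn.le
        have := lt_of_mul_lt_mul_left a2 hn.le
        simp; omega
    rw [← key]
    linarith
  have h3 : (q : ℤ) ^ m + 1 = 2 * n := by exact_mod_cast hN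
  -- Both sequences obey the same recursion, so their difference is multiplied by q at each step;
  -- being periodic, it vanishes.
  let e : ℕ → ℤ := fun j => signedVal q m b j - (n - r j)
  have estep : ∀ j, e (j + 1) = q * e j := by
    intro j
    have hs := wordVal_shift q m (shift_anti banti j)
    simp only [Nat.add_zero] at hs
    have : (fun k => b (j + 1 + k)) = fun k => b (j + (k + 1)) := by
      funext k; congr 1; ring
    simp only [e]
    rw [ustep, signedVal, signedVal, this, hs, h3]
    ring
  have epow : ∀ i j, e (j + i) = (q : ℤ) ^ i * e j := by
    intro i j
    induction i with
    | zero => simp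
    | succ i ih => rw [← add_assoc, estep, ih, pow_succ]; ring
  have eper : ∀ j, e (j + 2 * m) = e j := by
    intro j
    have h1 := rper 1 j
    rw [one_mul] at h1
    have h2 : (fun k => b (j + 2 * m + k)) = fun k => b (j + k) := by
      funext k
      rw [← banti.two_mul (j + k)]
      congr 1; ring
    simp only [e, signedVal, h1, h2, banti.two_mul j]
  have ezero : ∀ j, signedVal q m b j = n - r j := by
    intro j
    have h1 := epow (2 * m) j
    rw [eper] at h1
    have h4 : (1 : ℤ) < (q : ℤ) ^ (2 * m) := one_lt_pow₀ (by omega) (by omega)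
    have h5 : e j = 0 := by nlinarith [sq_nonneg (e j)]
    simp only [e] at h5
    linarith
  have b0 : b 0 = false := by rw [← Bool.not_eq_true, hb, r0]; omega
  have hval : (s : ℤ) = n - wordVal q m b := by
    have h1 := ezero 0
    simp only [signedVal, b0, r0, Nat.zero_add] at h1
    simp at h1
    linarith
  refine ⟨b, ⟨banti, b0, fun j => ?_⟩, hval⟩
  apply toLex_le_of_wordVal_le (q := q) (by omega) hm (relWord_anti banti j) banti
  rw [← abs_signedVal q m (by omega), ezero, abs_le]
  have := rge j
  have := rle j
  omega

/-! ### Ranking the leaders modulo 2n and modulo n -/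

theorem mem_cosetLeaders_two_mul {q n t : ℕ} (hn : 0 < n) :
    2 * t ∈ cosetLeaders q (2 * n) ↔ t ∈ cosetLeaders q n := by
  rw [mem_cosetLeaders_iff (by omega), mem_cosetLeaders_iff hn]
  have : ∀ j, 2 * t * q ^ j % (2 * n) = 2 * (t * q ^ j % n) := fun j => by
    rw [mul_assoc, Nat.mul_mod_mul_left]
  simp only [this]
  constructor
  · rintro ⟨h1, h2⟩
    exact ⟨by omega, fun j => by have := h2 j; omega⟩
  · rintro ⟨h1, h2⟩
    exact ⟨by omega, fun j => by have := h2 j; omega⟩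

/-- The coset leaders above the one that belongs to `e₃`. -/
theorem eq_of_cosetLeader_ge {q m n s₃ t : ℕ} (hq : 3 ≤ q) (hodd : Odd q) (hm : 0 < m)
    (hN : q ^ m + 1 = 2 * n) {e₁ e₂ e₃ : ℕ → Bool} (h : FirstThree m e₁ e₂ e₃)
    (h₃ : (s₃ : ℤ) = n - wordVal q m e₃) (ht : t ∈ cosetLeaders q (2 * n)) (hst : s₃ ≤ t) :
    t = n ∨ (t : ℤ) = n - wordVal q m e₁ ∨ (t : ℤ) = n - wordVal q m e₂ ∨ t = s₃ := by
  rcases (cosetLeader_le_half hN ht).eq_or_lt with h0 | h0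
  · exact Or.inl h0
  right
  have hv := wordVal_le (q := q) (by omega) hm h.top₃.zero
  -- Since e₃ starts with 0, q times its value is at most q^m, so every leader from s₃ up is close
  -- enough to n to come from a word.
  have hlt : q * (n - t) < 2 * n := by
    have h1 : ((n - t : ℕ) : ℤ) ≤ wordVal q m e₃ := by omega
    have h2 : (q : ℤ) * ((n - t : ℕ) : ℤ) ≤ q * wordVal q m e₃ :=
      mul_le_mul_of_nonneg_left h1 (by omega)
    have h3 : (q : ℤ) ^ m + 1 = 2 * n := by exact_mod_cast hN
    have h4 : ((q * (n - t) : ℕ) : ℤ) < 2 * n := by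
      rw [Nat.cast_mul]; linarith
    exact_mod_cast h4
  obtain ⟨b, hb, hbt⟩ := exists_isTopWord hq hodd hm hN ht h0 hlt
  have hle : toLex b ≤ toLex e₃ :=
    toLex_le_of_wordVal_le (q := q) (by omega) hm hb.anti h.top₃.anti (by omega)
  rcases h.eq_of_le b hb hle with rfl | rfl | rfl
  · exact Or.inl hbt
  · exact Or.inr (Or.inl hbt)
  · right; right; omega

/-- A decreasing triple of coset leaders modulo `n`. -/
structure FirstLeaders (q n s₁ s₂ s₃ : ℕ) : Prop where
  mem₁ : s₁ ∈ cosetLeaders q n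
  mem₂ : s₂ ∈ cosetLeaders q n
  mem₃ : s₃ ∈ cosetLeaders q n
  lt₂₁ : s₂ < s₁
  lt₃₂ : s₃ < s₂

theorem leaders_of_firstThree {q m n s₁ s₂ s₃ : ℕ} (hq : 3 ≤ q) (hodd : Odd q) (hm : 0 < m)
    (hN : q ^ m + 1 = 2 * n) {e₁ e₂ e₃ : ℕ → Bool} (h : FirstThree m e₁ e₂ e₃)
    (h₁ : (s₁ : ℤ) = n - wordVal q m e₁) (h₂ : (s₂ : ℤ) = n - wordVal q m e₂)
    (h₃ : (s₃ : ℤ) = n - wordVal q m e₃) :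
    FirstLeaders q (2 * n) s₁ s₂ s₃ ∧ s₁ < n ∧
      ∀ t ∈ cosetLeaders q (2 * n), s₃ ≤ t → t = n ∨ t = s₁ ∨ t = s₂ ∨ t = s₃ := by
  have l1 := wordVal_lt_wordVal (q := q) (by omega) hm h.top₁.anti h.top₂.anti h.lt₁₂
  have l2 := wordVal_lt_wordVal (q := q) (by omega) hm h.top₂.anti h.top₃.anti h.lt₂₃
  have l0 := one_le_wordVal (q := q) (by omega) m e₁
  refine ⟨⟨mem_cosetLeaders_of_isTopWord hq hodd hm hN h.top₁ h₁,
    mem_cosetLeaders_of_isTopWord hq hodd hm hN h.top₂ h₂,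
    mem_cosetLeaders_of_isTopWord hq hodd hm hN h.top₃ h₃, by omega, by omega⟩, by omega, ?_⟩
  intro t ht hst
  have := eq_of_cosetLeader_ge hq hodd hm hN h h₃ ht hst
  omega

theorem isNthLargest_two_mul {q n s₁ s₂ s₃ : ℕ} (hodd : Odd q) (hn : 0 < n)
    (h : FirstLeaders q (2 * n) s₁ s₂ s₃) (h0 : s₁ < n)
    (hall : ∀ t ∈ cosetLeaders q (2 * n), s₃ ≤ t → t = n ∨ t = s₁ ∨ t = s₂ ∨ t = s₃) :
    IsNthLargestCosetLeader q (2 * n) 2 s₁ ∧ IsNthLargestCosetLeader q (2 * n) 3 s₂ ∧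
      IsNthLargestCosetLeader q (2 * n) 4 s₃ := by
  obtain ⟨m1, m2, m3, l1, l2⟩ := h
  have m0 := half_mem_cosetLeaders hodd hn
  have e1 : {t ∈ cosetLeaders q (2 * n) | s₁ < t} = {n} := by
    ext t
    simp only [Set.mem_ofPred_eq, Set.mem_singleton_iff]
    constructor
    · rintro ⟨h1, h2⟩
      have := hall t h1 (by omega); omega
    · rintro rfl
      exact ⟨m0, h0⟩
  have e2 : {t ∈ cosetLeaders q (2 * n) | s₂ < t} = {n, s₁} := by
    ext t
    simp only [Set.mem_ofPred_eq, Set.mem_singleton_iff, Set.mem_insert_iff]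
    constructor
    · rintro ⟨h1, h2⟩
      have := hall t h1 (by omega); omega
    · rintro (rfl | rfl)
      exacts [⟨m0, by omega⟩, ⟨m1, by omega⟩]
  have e3 : {t ∈ cosetLeaders q (2 * n) | s₃ < t} = {n, s₁, s₂} := by
    ext t
    simp only [Set.mem_ofPred_eq, Set.mem_singleton_iff, Set.mem_insert_iff]
    constructor
    · rintro ⟨h1, h2⟩
      have := hall t h1 (by omega); omega
    · rintro (rfl | rfl | rfl)
      exacts [⟨m0, by omega⟩, ⟨m1, by omega⟩, ⟨m2, by omega⟩]
  refine ⟨⟨m1, ?_⟩, ⟨m2, ?_⟩, ⟨m3, ?_⟩⟩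
  · rw [e1, Set.ncard_singleton]
  · rw [e2, Set.ncard_pair (by omega)]
  · rw [e3, Set.ncard_eq_three.mpr ⟨n, s₁, s₂, by omega, by omega, by omega, rfl⟩]

theorem isNthLargest_half {q n d₁ d₂ d₃ : ℕ} (h : FirstLeaders q n d₁ d₂ d₃)
    (hall : ∀ t ∈ cosetLeaders q n, d₃ ≤ t → t = d₁ ∨ t = d₂ ∨ t = d₃) :
    IsNthLargestCosetLeader q n 1 d₁ ∧ IsNthLargestCosetLeader q n 2 d₂ ∧
      IsNthLargestCosetLeader q n 3 d₃ := by
  obtain ⟨m1, m2, m3, l1, l2⟩ := h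
  have e1 : {t ∈ cosetLeaders q n | d₁ < t} = ∅ := by
    ext t
    simp only [Set.mem_ofPred_eq, Set.mem_empty_iff_false, iff_false]
    rintro ⟨h1, h2⟩
    have := hall t h1 (by omega); omega
  have e2 : {t ∈ cosetLeaders q n | d₂ < t} = {d₁} := by
    ext t
    simp only [Set.mem_ofPred_eq, Set.mem_singleton_iff]
    constructor
    · rintro ⟨h1, h2⟩
      have := hall t h1 (by omega); omega
    · rintro rfl
      exact ⟨m1, by omega⟩
  have e3 : {t ∈ cosetLeaders q n | d₃ < t} = {d₁, d₂} := by
    ext t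
    simp only [Set.mem_ofPred_eq, Set.mem_singleton_iff, Set.mem_insert_iff]
    constructor
    · rintro ⟨h1, h2⟩
      have := hall t h1 (by omega); omega
    · rintro (rfl | rfl)
      exacts [⟨m1, by omega⟩, ⟨m2, by omega⟩]
  refine ⟨⟨m1, ?_⟩, ⟨m2, ?_⟩, ⟨m3, ?_⟩⟩
  · rw [e1, Set.ncard_empty]
  · rw [e2, Set.ncard_singleton]
  · rw [e3, Set.ncard_pair (by omega)]

/-- Leaders modulo n are the halves of the even leaders modulo 2n; n itself is odd and drops out,
which lowers each rank by one. -/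
theorem firstLeaders_half {q n d₁ d₂ d₃ : ℕ} (hn : Odd n)
    (h : FirstLeaders q (2 * n) (2 * d₁) (2 * d₂) (2 * d₃))
    (hall : ∀ t ∈ cosetLeaders q (2 * n), 2 * d₃ ≤ t →
      t = n ∨ t = 2 * d₁ ∨ t = 2 * d₂ ∨ t = 2 * d₃) :
    FirstLeaders q n d₁ d₂ d₃ ∧
      ∀ t ∈ cosetLeaders q n, d₃ ≤ t → t = d₁ ∨ t = d₂ ∨ t = d₃ := by
  obtain ⟨m1, m2, m3, l1, l2⟩ := h
  rw [mem_cosetLeaders_two_mul hn.pos] at m1 m2 m3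
  refine ⟨⟨m1, m2, m3, by omega, by omega⟩, fun t ht hdt => ?_⟩
  have := hall (2 * t) ((mem_cosetLeaders_two_mul hn.pos).mpr ht) (by omega)
  obtain ⟨k, rfl⟩ := hn
  omega

/-- The size of the coset that belongs to a strict top word. -/
theorem ncard_cyclotomicCoset {q m n d l : ℕ} (hq : 3 ≤ q) (hodd : Odd q) (hm : 0 < m)
    (hN : q ^ m + 1 = 2 * n) {b : ℕ → Bool} (hl : 0 < l) (h : IsStrictTopWord l b)
    (ha : IsAnti m b) (hd : ((2 * d : ℕ) : ℤ) = n - wordVal q m b) :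
    (cyclotomicCoset q n d).ncard = 2 * l := by
  have hn : 0 < n := by have := Nat.pow_pos (n := m) (show 0 < q by omega); omega
  have hr : ∀ j, 2 * (d * q ^ j % n) = 2 * d * q ^ j % (2 * n) := fun j => by
    rw [mul_assoc, Nat.mul_mod_mul_left]
  have hv := fun j => mul_pow_mod_eq hq hodd hm hN ha hd j
  -- A residue determines the sign of its signed value, hence the letter; so a repetition in the
  -- coset becomes a period of b.
  have hsgn : ∀ i j, d * q ^ i % n = d * q ^ j % n → b i = b j := by
    intro i j hij
    have h1 : signedVal q m b i = signedVal q m b j := by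
      have := hv i
      have := hv j
      have := hr i
      have := hr j
      omega
    rw [signedVal_eq, signedVal_eq] at h1
    have p1 := one_le_wordVal (q := q) (by omega) m (relWord b i)
    have p2 := one_le_wordVal (q := q) (by omega) m (relWord b j)
    cases hi : b i <;> cases hj : b j <;> simp [hi, hj] at h1 ⊢ <;> omega
  have hper : ∀ j, d * q ^ (j + 2 * l) % n = d * q ^ j % n := by
    intro j
    have h1 : signedVal q m b (j + 2 * l) = signedVal q m b j := by
      have : (fun k => b (j + 2 * l + k)) = fun k => b (j + k) := by
        funext k
        rw [← h.anti.two_mul (j + k)]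
        congr 1; ring
      rw [signedVal, signedVal, h.anti.two_mul, this]
    have := hv (j + 2 * l)
    have := hv j
    have := hr (j + 2 * l)
    have := hr j
    omega
  have hcop : Nat.Coprime n q := by
    rw [Nat.coprime_comm]
    apply Nat.Coprime.coprime_mul_left_right (k := 2)
    rw [← hN]
    apply (Nat.coprime_add_iff_right (dvd_pow_self q hm.ne')).mpr
    exact Nat.coprime_one_right q
  have hset : cyclotomicCoset q n d =
      (fun j => d * q ^ j % n) '' (Finset.range (2 * l) : Set ℕ) := by
    ext x
    simp only [cyclotomicCoset, Set.mem_ofPred_eq, Set.mem_image, Finset.coe_range, Set.mem_Iio]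
    constructor
    · rintro ⟨j, rfl⟩
      refine ⟨j % (2 * l), Nat.mod_lt _ (by omega), ?_⟩
      have : ∀ k i, d * q ^ (i + k * (2 * l)) % n = d * q ^ i % n := by
        intro k i
        induction k with
        | zero => simp
        | succ k ih => rw [← ih, ← hper (i + k * (2 * l))]; congr 3; ring
      rw [← this (j / (2 * l)), Nat.mod_add_div']
    · rintro ⟨j, -, rfl⟩
      exact ⟨j, rfl⟩
  have hinj : ∀ i j, i < j → j < 2 * l → d * q ^ i % n ≠ d * q ^ j % n := by
    intro i j hij hj he
    obtain ⟨t, rfl⟩ := Nat.exists_eq_add_of_le hij.le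
    have h1 : d * 1 * q ^ i ≡ d * q ^ t * q ^ i [MOD n] := by
      rw [mul_one, mul_assoc, ← pow_add, add_comm t i]
      exact he
    have h2 : d * 1 ≡ d * q ^ t [MOD n] :=
      Nat.ModEq.cancel_right_of_coprime (Nat.Coprime.pow_right i hcop) h1
    have h3 : ∀ k, b (k + t) = b k := by
      intro k
      apply hsgn
      have := h2.mul_right (q ^ k)
      rw [mul_one, mul_assoc, ← pow_add, add_comm t k] at this
      exact this.symm
    have := Nat.le_of_dvd (by omega) (h.dvd_of_period hl h3)
    omega
  rw [hset, Set.InjOn.ncard_image, Set.ncard_coe_finset, Finset.card_range]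
  intro i hi j hj he
  simp only [Finset.coe_range, Set.mem_Iio] at hi hj
  rcases lt_trichotomy i j with h1 | h1 | h1
  · exact absurd he (hinj i j h1 hj)
  · exact h1
  · exact absurd he.symm (hinj j i h1 hi)

/-! ### The values of the words -/

theorem wordSum_congr (q m : ℕ) {b b' : ℕ → Bool} (h : ∀ k < m, b k = b' k) :
    wordSum q m b = wordSum q m b' :=
  Finset.sum_congr rfl fun k hk => by rw [h k (Finset.mem_range.mp hk)]

theorem wordSum_succ_last (q m : ℕ) (b : ℕ → Bool) :
    wordSum q (m + 1) b = q * wordSum q m b + ((b m).toNat : ℤ) := by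
  have h1 := wordSum_succ q m b
  rw [wordSum_shift] at h1
  linarith

theorem wordSum_mu (q m : ℕ) (c : ℕ → Bool) :
    ((q : ℤ) ^ 2 - 1) * wordSum q (2 * m) (mu c) =
      (q : ℤ) ^ (2 * m) - 1 + (q - 1) * (((q : ℤ) ^ 2 - 1) * wordSum (q ^ 2) m c) := by
  induction m with
  | zero => simp [wordSum]
  | succ m ih =>
    rw [show 2 * (m + 1) = 2 * m + 1 + 1 by ring, wordSum_succ_last, wordSum_succ_last,
      wordSum_succ_last, mu_even, mu_odd, pow_succ, pow_succ]
    push_cast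
    cases c m <;> simp <;> linear_combination (q : ℤ) ^ 2 * ih

/-- Each block of `mu c` is a base-q² digit, 1 for 01 and q for 10, that is 1 + (q-1)c_k. -/
theorem wordVal_mu (q m : ℕ) (c : ℕ → Bool) :
    ((q : ℤ) + 1) * wordVal q (2 * m) (mu c) =
      (q : ℤ) ^ (2 * m) + 1 + (q - 1) * wordVal (q ^ 2) m c := by
  have h := wordSum_mu q m c
  simp only [wordVal]
  push_cast
  linear_combination h

/-- The word `101010…`. -/
def evenWord : ℕ → Bool := fun k => decide (k % 2 = 0)

theorem wordSum_evenWord (q t : ℕ) :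
    ((q : ℤ) ^ 2 - 1) * wordSum q (2 * t) evenWord = (q : ℤ) ^ (2 * t + 1) - q := by
  induction t with
  | zero => simp [wordSum]
  | succ t ih =>
    rw [show 2 * (t + 1) = 2 * t + 1 + 1 by ring, wordSum_succ_last, wordSum_succ_last]
    have h1 : evenWord (2 * t) = true := by simp [evenWord]
    have h2 : evenWord (2 * t + 1) = false := by simp [evenWord, Nat.add_mod]
    rw [h1, h2]
    simp
    linear_combination (q : ℤ) ^ 2 * ih

theorem wordVal_altWord (q t : ℕ) :
    ((q : ℤ) + 1) * wordVal q (2 * t + 1) altWord = (q : ℤ) ^ (2 * t + 1) + 1 := by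
  have h1 : (fun k => altWord (k + 1)) = evenWord := by
    funext k
    rw [Bool.eq_iff_iff]
    simp only [altWord, evenWord, decide_eq_true_iff]
    omega
  rw [wordVal, wordSum_succ, h1]
  simp [altWord]
  linear_combination wordSum_evenWord q t

theorem wordVal_secondWord (q t : ℕ) :
    ((q : ℤ) + 1) * wordVal q (2 * t + 3) (secondWord (2 * t + 3)) =
      (q : ℤ) ^ (2 * t + 3) + (q : ℤ) ^ (2 * t + 2) - (q : ℤ) ^ (2 * t + 1) + q := by
  have h1 : wordSum q (2 * t + 3) (secondWord (2 * t + 3)) = wordSum q (2 * t + 3) muMax :=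
    wordSum_congr q _ fun k hk => antiExt_of_lt _ hk
  have h2 : (fun k => muMax (k + 1 + 1)) = evenWord := by
    funext k
    rw [Bool.eq_iff_iff, muMax_iff, evenWord, decide_eq_true_iff]
    omega
  have h3 : evenWord (2 * t) = true := by simp [evenWord]
  have h4 : muMax 0 = false := by decide
  have h5 : muMax (0 + 1) = true := by decide
  rw [wordVal, h1, show 2 * t + 3 = 2 * t + 1 + 1 + 1 by ring, wordSum_succ, wordSum_succ, h2,
    wordSum_succ_last, h3, h4, h5]
  simp
  linear_combination (q : ℤ) * wordSum_evenWord q t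

/-- The two words differ only in their last two letters, 10 against 01. -/
theorem wordVal_thirdWord (q t : ℕ) :
    wordVal q (2 * t + 5) (thirdWord (2 * t + 5)) =
      wordVal q (2 * t + 5) (secondWord (2 * t + 5)) + ((q : ℤ) - 1) ^ 2 := by
  have h1 : wordSum q (2 * t + 3) (thirdWord (2 * t + 5)) =
      wordSum q (2 * t + 3) (secondWord (2 * t + 5)) := by
    refine wordSum_congr q _ fun k hk => ?_
    rw [Bool.eq_iff_iff, thirdWord_iff (by omega), secondWord_iff (by omega)]
    omega
  have a1 : thirdWord (2 * t + 5) (2 * t + 3) = true := by rw [thirdWord_iff (by omega)]; omega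
  have a2 : thirdWord (2 * t + 5) (2 * t + 3 + 1) = false := by
    rw [← Bool.not_eq_true, thirdWord_iff (by omega)]; omega
  have b1 : secondWord (2 * t + 5) (2 * t + 3) = false := by
    rw [← Bool.not_eq_true, secondWord_iff (by omega)]; omega
  have b2 : secondWord (2 * t + 5) (2 * t + 3 + 1) = true := by
    rw [secondWord_iff (by omega)]; omega
  have hs : ∀ b, wordSum q (2 * t + 5) b =
      q * (q * wordSum q (2 * t + 3) b + ((b (2 * t + 3)).toNat : ℤ)) +
      ((b (2 * t + 3 + 1)).toNat : ℤ) := fun b => by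
    rw [← wordSum_succ_last, ← wordSum_succ_last]
  rw [wordVal, wordVal, hs, hs, h1, a1, a2, b1, b2]
  simp
  ring

theorem wordVal_sixWord (q : ℕ) :
    wordVal q 6 sixWord = wordVal q 6 (mu (secondWord 3)) + q * ((q : ℤ) - 1) ^ 2 := by
  have a : ∀ k < 6, sixWord k = decide (k = 1 ∨ k = 2 ∨ k = 3) := by decide
  have b : ∀ k < 6, mu (secondWord 3) k = decide (k = 1 ∨ k = 2 ∨ k = 4) := by decide
  rw [wordVal, wordVal, wordSum_congr q 6 a, wordSum_congr q 6 b]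
  simp [wordSum, Finset.sum_range_succ]
  ring

/-! ### Closed formulas for the leaders in terms of Ψ -/

theorem Psi_zero (q : ℕ) : Psi q 0 = ((q : ℚ) - 1) ^ 2 / 2 := by
  simp [Psi]; ring

theorem Psi_one (q : ℕ) : Psi q 1 = ((q : ℚ) - 1) ^ 2 * ((q : ℚ) ^ 2 - 1) / 2 := by
  simp [Psi, Finset.prod_range_succ]; ring

theorem Psi_two (q : ℕ) :
    Psi q 2 = ((q : ℚ) - 1) ^ 2 * ((q : ℚ) ^ 2 - 1) * ((q : ℚ) ^ 4 - 1) / 2 := by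
  simp [Psi, Finset.prod_range_succ]; ring

/-- The difference of half the modulus and the value of a word. -/
def wordDefect (q m : ℕ) (b : ℕ → Bool) : ℚ := ((q : ℚ) ^ m + 1) / 2 - wordVal q m b

/-- In terms of leaders the affine rule for values becomes linear, so identities over q² transfer to
q. -/
theorem wordDefect_mu (q m : ℕ) (c : ℕ → Bool) :
    wordDefect q (2 * m) (mu c) = ((q : ℚ) - 1) / (q + 1) * wordDefect (q ^ 2) m c := by
  have h : ((q : ℚ) + 1) * wordVal q (2 * m) (mu c) =
      (q : ℚ) ^ (2 * m) + 1 + (q - 1) * wordVal (q ^ 2) m c := by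
    exact_mod_cast wordVal_mu q m c
  have h0 : (q : ℚ) + 1 ≠ 0 := by positivity
  rw [wordDefect, wordDefect, div_mul_eq_mul_div, eq_div_iff h0]
  push_cast
  rw [← pow_mul]
  linear_combination -h

theorem wordDefect_altWord (q t : ℕ) :
    wordDefect q (2 * t + 3) altWord = ((q : ℚ) ^ (2 * t + 3) + 1) * (q - 1) / (2 * (q + 1)) := by
  have h : ((q : ℚ) + 1) * wordVal q (2 * t + 3) altWord = (q : ℚ) ^ (2 * t + 3) + 1 := by
    exact_mod_cast wordVal_altWord q (t + 1)
  have h0 : 2 * ((q : ℚ) + 1) ≠ 0 := by positivity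
  rw [wordDefect, eq_div_iff h0]
  linear_combination -2 * h

theorem wordDefect_secondWord {q : ℕ} (hq : 0 < q) (t : ℕ) :
    wordDefect q (2 * t + 3) (secondWord (2 * t + 3)) =
      wordDefect q (2 * t + 3) altWord -
      (q - 1) * ((q : ℚ) ^ (2 * t + 3) + q ^ 2) / ((q + 1) * q ^ 2) := by
  have h : ((q : ℚ) + 1) * wordVal q (2 * t + 3) (secondWord (2 * t + 3)) =
      (q : ℚ) ^ (2 * t + 3) + (q : ℚ) ^ (2 * t + 2) - (q : ℚ) ^ (2 * t + 1) + q := by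
    exact_mod_cast wordVal_secondWord q t
  have h0 : ((q : ℚ) + 1) * q ^ 2 ≠ 0 := by positivity
  rw [wordDefect_altWord, wordDefect, eq_sub_iff_add_eq, add_div' _ _ _ h0,
    div_eq_div_iff h0 (by positivity)]
  rw [pow_succ] at h ⊢
  linear_combination -2 * (q + 1) * (q : ℚ) ^ 2 * h

theorem wordDefect_thirdWord (q t : ℕ) :
    wordDefect q (2 * t + 5) (thirdWord (2 * t + 5)) =
      wordDefect q (2 * t + 5) (secondWord (2 * t + 5)) - ((q : ℚ) - 1) ^ 2 := by
  rw [wordDefect, wordDefect, wordVal_thirdWord]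
  push_cast; ring

theorem wordDefect_sixWord (q : ℕ) :
    wordDefect q 6 sixWord = wordDefect q 6 (mu (secondWord 3)) - q * ((q : ℚ) - 1) ^ 2 := by
  rw [wordDefect, wordDefect, wordVal_sixWord]
  push_cast; ring

theorem wordDefect_mu_altWord {q : ℕ} (hq : 0 < q) (t : ℕ) :
    wordDefect q (2 * (2 * t + 3)) (mu altWord) =
      ((q : ℚ) ^ (2 * (2 * t + 3)) + 1) / ((q : ℚ) ^ 2 + 1) * Psi q 0 := by
  have : (0 : ℚ) < q := by exact_mod_cast hq
  rw [wordDefect_mu, wordDefect_altWord, Psi_zero]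
  push_cast
  rw [← pow_mul]
  generalize (q : ℚ) ^ (2 * (2 * t + 3)) = Y
  field_simp
  ring

theorem wordDefect_mu_secondWord {q : ℕ} (hq : 0 < q) (t : ℕ) :
    wordDefect q (2 * (2 * t + 3)) (mu (secondWord (2 * t + 3))) =
      wordDefect q (2 * (2 * t + 3)) (mu altWord) -
        2 * ((wordDefect q (2 * (2 * t + 3)) (mu altWord) + Psi q 1) / (q : ℚ) ^ 4) := by
  have : (0 : ℚ) < q := by exact_mod_cast hq
  rw [wordDefect_mu, wordDefect_mu, wordDefect_secondWord (by positivity), wordDefect_altWord,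
    Psi_one]
  push_cast
  rw [← pow_mul]
  generalize (q : ℚ) ^ (2 * (2 * t + 3)) = Y
  field_simp
  ring

theorem wordDefect_mu_thirdWord (q t : ℕ) :
    wordDefect q (2 * (2 * t + 5)) (mu (thirdWord (2 * t + 5))) =
      wordDefect q (2 * (2 * t + 5)) (mu (secondWord (2 * t + 5))) - 2 * Psi q 1 := by
  have : (0 : ℚ) < q + 1 := by positivity
  rw [wordDefect_mu, wordDefect_mu, wordDefect_thirdWord, Psi_one]
  push_cast
  field_simp
  ring

theorem wordDefect_sixWord' (q : ℕ) :
    wordDefect q 6 sixWord = wordDefect q 6 (mu (secondWord 3)) - 2 * q * Psi q 0 := by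
  rw [wordDefect_sixWord, Psi_zero]; ring

/-- Replacing q by q² shifts the factors q^(2^j) - 1 by one; the prefactor (q-1)/(q+1) supplies the
missing one and corrects (q²-1)/2. -/
theorem Psi_sq_zero (q : ℕ) : ((q : ℚ) - 1) / (q + 1) * Psi (q ^ 2) 0 = Psi q 1 := by
  have : (0 : ℚ) < q + 1 := by positivity
  rw [Psi_zero, Psi_one]
  push_cast
  field_simp
  ring

theorem Psi_sq_one (q : ℕ) : ((q : ℚ) - 1) / (q + 1) * Psi (q ^ 2) 1 = Psi q 2 := by
  have : (0 : ℚ) < q + 1 := by positivity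
  rw [Psi_one, Psi_two]
  push_cast
  field_simp
  ring

theorem wordDefect_mu_first {q m : ℕ} {e : ℕ → Bool}
    (h : wordDefect (q ^ 2) m e =
      (((q ^ 2 : ℕ) : ℚ) ^ m + 1) / (((q ^ 2 : ℕ) : ℚ) ^ 2 + 1) * Psi (q ^ 2) 0) :
    wordDefect q (2 * m) (mu e) = ((q : ℚ) ^ (2 * m) + 1) / ((q : ℚ) ^ 4 + 1) * Psi q 1 := by
  rw [wordDefect_mu, h, ← Psi_sq_zero]
  push_cast
  rw [← pow_mul, ← pow_mul]
  ring

theorem wordDefect_mu_second {q m : ℕ} {e e' : ℕ → Bool}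
    (h : wordDefect (q ^ 2) m e' = wordDefect (q ^ 2) m e -
      2 * ((wordDefect (q ^ 2) m e + Psi (q ^ 2) 1) / ((q ^ 2 : ℕ) : ℚ) ^ 4)) :
    wordDefect q (2 * m) (mu e') = wordDefect q (2 * m) (mu e) -
      2 * ((wordDefect q (2 * m) (mu e) + Psi q 2) / (q : ℚ) ^ 8) := by
  rw [wordDefect_mu, wordDefect_mu, h, ← Psi_sq_one]
  push_cast
  rw [← pow_mul]
  ring

/-- The words of the three largest coset leaders below `(q ^ m + 1) / 2`, and their values. -/
theorem exists_words {q m ν : ℕ} (hq : 3 ≤ q) (hν : ν = 1 ∨ ν = 2) {p : ℕ} (hp : p % 2 = 1)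
    (h3 : 3 ≤ p) (hm : m = 2 ^ ν * p) :
    ∃ e₁ e₂ e₃ : ℕ → Bool, FirstThree m e₁ e₂ e₃ ∧ IsStrictTopWord (2 ^ ν) e₁ ∧
      IsStrictTopWord m e₂ ∧ IsStrictTopWord m e₃ ∧
      (wordDefect q m e₁ = ((q : ℚ) ^ m + 1) / ((q : ℚ) ^ (2 ^ ν) + 1) * Psi q ((ν : ℤ) - 1) ∧
      wordDefect q m e₂ = wordDefect q m e₁ -
        2 * ((wordDefect q m e₁ + Psi q (ν : ℤ)) / (q : ℚ) ^ (2 ^ (ν + 1))) ∧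
      wordDefect q m e₃ = if m = 2 ^ ν + 2 ^ (ν + 1)
        then wordDefect q m e₂ - 2 * (q : ℚ) ^ (2 ^ (ν - 1)) * Psi q ((ν : ℤ) - 1)
        else wordDefect q m e₂ - 2 * Psi q (ν : ℤ)) := by
  obtain ⟨t, rfl⟩ : ∃ t, p = 2 * t + 3 := ⟨(p - 3) / 2, by omega⟩
  have s1 := altWord_isStrictTopWord.map_mu one_pos
  have s2 := (secondWord_isStrictTopWord hp h3).map_mu (by omega)
  have w2 := s2.map_mu (by omega)
  have d1 := fun Q hQ => wordDefect_mu_altWord (q := Q) hQ t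
  have d2 := fun Q hQ => wordDefect_mu_secondWord (q := Q) hQ t
  have hq2 : 0 < q ^ 2 := by positivity
  have p0 := Psi_sq_zero q
  have p1 := Psi_sq_one q
  -- The case t = 0 is p = 3, the exceptional m = 2^ν + 2^(ν+1), where the third word comes from
  -- `sixWord`.
  rcases Nat.eq_zero_or_pos t with rfl | ht
  · rcases hν with rfl | rfl
    · subst hm
      refine ⟨_, _, _, firstThree_six, s1, s2, sixWord_isStrictTopWord, ?_⟩
      have := d1 q (by omega)
      have := d2 q (by omega)
      have := wordDefect_sixWord' q
      norm_num at *
      exact ⟨‹_›, ‹_›, ‹_›⟩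
    · subst hm
      refine ⟨_, _, _, firstThree_six.map_mu, s1.map_mu (by omega), w2,
        sixWord_isStrictTopWord.map_mu (by omega), ?_⟩
      have e1 := d1 (q ^ 2) hq2
      have e2 := d2 (q ^ 2) hq2
      have e3 := wordDefect_sixWord' (q ^ 2)
      refine ⟨wordDefect_mu_first e1, wordDefect_mu_second e2, ?_⟩
      rw [if_pos (by norm_num)]
      change wordDefect q (2 * 6) (mu sixWord) = wordDefect q (2 * 6) (mu (mu (secondWord 3))) -
        2 * (q : ℚ) ^ 2 * Psi q 1
      rw [wordDefect_mu, wordDefect_mu, e3, ← p0]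
      push_cast
      ring
  · obtain ⟨t, rfl⟩ := Nat.exists_eq_add_of_le' ht
    have h3 := thirdWord_isStrictTopWord hp (by omega)
    have d3 := fun Q => wordDefect_mu_thirdWord Q t
    rcases hν with rfl | rfl
    · subst hm
      refine ⟨_, _, _, (firstThree_of_odd hp (by omega)).map_mu, s1, s2, h3.map_mu (by omega), ?_⟩
      refine ⟨d1 q (by omega), d2 q (by omega), ?_⟩
      rw [if_neg (by omega)]
      exact d3 q
    · obtain rfl : m = 2 * (2 * (2 * (t + 1) + 3)) := by rw [hm]; ring
      refine ⟨_, _, _, (firstThree_of_odd hp (by omega)).map_mu.map_mu, s1.map_mu (by omega), w2,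
        (h3.map_mu (by omega)).map_mu (by omega), ?_⟩
      refine ⟨wordDefect_mu_first (d1 _ hq2), wordDefect_mu_second (d2 _ hq2), ?_⟩
      have e3 := d3 (q ^ 2)
      rw [if_neg (by omega)]
      change wordDefect q (2 * (2 * (2 * (t + 1) + 3))) (mu (mu (thirdWord (2 * t + 5)))) =
        wordDefect q (2 * (2 * (2 * (t + 1) + 3))) (mu (mu (secondWord (2 * t + 5)))) - 2 * Psi q 2
      rw [wordDefect_mu q _ (mu (thirdWord _)), wordDefect_mu q _ (mu (secondWord _))]
      change _ * wordDefect (q ^ 2) (2 * (2 * t + 5)) (mu (thirdWord (2 * t + 5))) =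
        _ * wordDefect (q ^ 2) (2 * (2 * t + 5)) (mu (secondWord (2 * t + 5))) - 2 * Psi q 2
      rw [e3, ← p1]
      ring

/-! ### Cyclic codes given by a set of zeros -/

section Codes

variable {K : Type*} [Field K] {L : Type*} [Field L] [Algebra K L] {n : ℕ} {β : L}

theorem aeval_wordPoly (c : Fin n → K) (x : L) :
    aeval x (wordPoly c) = ∑ i : Fin n, algebraMap K L (c i) * x ^ (i : ℕ) := by
  simp [wordPoly, map_sum]

theorem wordPoly_add (a b : Fin n → K) : wordPoly (a + b) = wordPoly a + wordPoly b := by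
  simp [wordPoly, add_mul, Finset.sum_add_distrib]

theorem wordPoly_smul (r : K) (a : Fin n → K) : wordPoly (r • a) = Polynomial.C r * wordPoly a := by
  simp [wordPoly, Finset.mul_sum, mul_assoc]

theorem wordPoly_coeff (p : K[X]) (hp : p.degree < n) :
    wordPoly (fun i : Fin n => p.coeff i) = p := by
  by_cases h : p = 0
  · simp [wordPoly, h]
  · rw [wordPoly, Fin.sum_univ_eq_sum_range (fun i => Polynomial.C (p.coeff i) * X ^ i) n]
    conv_rhs => rw [p.as_sum_range' n ((natDegree_lt_iff_degree_lt h).mpr hp)]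
    simp [C_mul_X_pow_eq_monomial]

theorem wordPoly_degree_lt (c : Fin n → K) : (wordPoly c).degree < n := by
  refine mem_degreeLT.mp (Submodule.sum_mem _ fun i _ => mem_degreeLT.mpr ?_)
  exact (degree_C_mul_X_pow_le _ _).trans_lt (by exact_mod_cast i.2)

theorem wordPoly_eq_zero {c : Fin n → K} (h : wordPoly c = 0) : c = 0 := by
  funext i
  have := congrArg (fun p => p.coeff i) h
  simpa [wordPoly, finsetSum_coeff, coeff_C_mul, coeff_X_pow, Fin.val_inj] using this

theorem mem_cyclicCode_iff {g : K[X]} (hg : g ∣ X ^ n - 1) (c : Fin n → K) :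
    c ∈ cyclicCode n g ↔ g ∣ wordPoly c := by
  change Ideal.Quotient.mk (Ideal.span {(X ^ n - 1 : K[X])}) (wordPoly c) ∈
    Ideal.span {Ideal.Quotient.mk (Ideal.span {(X ^ n - 1 : K[X])}) g} ↔ _
  rw [Ideal.mem_span_singleton]
  constructor
  · rintro ⟨x, hx⟩
    obtain ⟨a, rfl⟩ := Ideal.Quotient.mk_surjective x
    rw [← map_mul, Ideal.Quotient.eq, Ideal.mem_span_singleton] at hx
    have h := hg.trans hx
    exact (dvd_sub_left (dvd_mul_right g a)).mp h
  · rintro ⟨a, ha⟩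
    rw [ha, map_mul]
    exact dvd_mul_right _ _

theorem mem_bchCode_iff (hβ : β ^ n = 1) (δ : ℕ) (c : Fin n → K) :
    c ∈ bchCode K n β (δ + 1) 0 ↔ ∀ j < δ, aeval (β ^ j) (wordPoly c) = 0 := by
  have hpow : ∀ j : ℕ, β ^ ((0 : ℤ) + (j : ℤ)) = β ^ j := fun j => by simp
  rw [bchCode, mem_cyclicCode_iff, bchGenerator_dvd_iff]
  · simp only [Nat.add_sub_cancel, Finset.mem_range, hpow, minpoly.dvd_iff]
  · rw [bchGenerator_dvd_iff]
    intro j _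
    rw [hpow, minpoly.dvd_iff]
    simp only [map_sub, map_pow, aeval_X, map_one]
    rw [← pow_mul, mul_comm, pow_mul, hβ, one_pow, sub_self]

theorem aeval_pow_card [Fintype K] {x : L} {p : K[X]} (h : aeval x p = 0) :
    aeval (x ^ Fintype.card K) p = 0 := by
  have := aeval_algHom_apply (FiniteField.frobeniusAlgHom K L) x p
  rw [h, map_zero] at this
  exact this

/-- The polynomial X^|K| - X has at most |K| roots in L, and K already provides that many. -/
theorem mem_range_of_pow_card_eq [Fintype K] {x : L} (h : x ^ Fintype.card K = x) :
    x ∈ Set.range (algebraMap K L) := by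
  classical
  have h1 : (X ^ Fintype.card K - X : L[X]) ≠ 0 :=
    FiniteField.X_pow_card_sub_X_ne_zero L Fintype.one_lt_card
  have h2 : Finset.univ.image (algebraMap K L) ⊆
      (X ^ Fintype.card K - X : L[X]).roots.toFinset := by
    intro y hy
    obtain ⟨a, -, rfl⟩ := Finset.mem_image.mp hy
    rw [Multiset.mem_toFinset, mem_roots h1]
    simp [← map_pow, FiniteField.pow_card]
  have h3 : (Finset.univ.image (algebraMap K L)).card = Fintype.card K := by
    rw [Finset.card_image_of_injective _ (algebraMap K L).injective, Finset.card_univ]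
  have h4 : (X ^ Fintype.card K - X : L[X]).roots.toFinset.card ≤ Fintype.card K := by
    refine (Multiset.toFinset_card_le _).trans ((card_roots' _).trans ?_)
    rw [FiniteField.X_pow_card_sub_X_natDegree_eq L Fintype.one_lt_card]
  have h5 := Finset.eq_of_subset_of_card_le h2 (by omega)
  have h6 : x ∈ (X ^ Fintype.card K - X : L[X]).roots.toFinset := by
    rw [Multiset.mem_toFinset, mem_roots h1]
    simp [h]
  rw [← h5] at h6
  obtain ⟨a, -, ha⟩ := Finset.mem_image.mp h6
  exact ⟨a, ha⟩

/-- The polynomial with a Frobenius-stable set of zeros descends to the finite field. -/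
theorem exists_map_eq_prod [Fintype K] (hβ : IsPrimitiveRoot β n)
    (hcop : Nat.Coprime n (Fintype.card K)) (Z : Finset ℕ) (hZn : ∀ i ∈ Z, i < n)
    (hZ : ∀ i ∈ Z, i * Fintype.card K % n ∈ Z) :
    ∃ P : K[X], P.map (algebraMap K L) = ∏ i ∈ Z, (X - C (β ^ i)) ∧ P.natDegree = Z.card ∧
      P.Monic := by
  set q := Fintype.card K
  have hmonic : (∏ i ∈ Z, (X - C (β ^ i))).Monic :=
    monic_prod_of_monic _ _ fun i _ => monic_X_sub_C _
  have hinj : Set.InjOn (fun i => i * q % n) Z := by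
    intro i hi j hj hij
    have : i ≡ j [MOD n] := Nat.ModEq.cancel_right_of_coprime hcop hij
    rwa [Nat.ModEq, Nat.mod_eq_of_lt (hZn i hi), Nat.mod_eq_of_lt (hZn j hj)] at this
  have himg : Z.image (fun i => i * q % n) = Z := by
    apply Finset.eq_of_subset_of_card_le
    · intro x hx
      obtain ⟨i, hi, rfl⟩ := Finset.mem_image.mp hx
      exact hZ i hi
    · rw [Finset.card_image_of_injOn hinj]
  have hmod : ∀ i, β ^ (i % n) = β ^ i := fun i => (pow_eq_pow_mod i hβ.pow_eq_one).symm
  have hfix : (∏ i ∈ Z, (X - C (β ^ i))).map (FiniteField.frobeniusAlgHom K L : L →+* L) =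
      ∏ i ∈ Z, (X - C (β ^ i)) := by
    conv_rhs => rw [← himg, Finset.prod_image hinj]
    rw [Polynomial.map_prod]
    refine Finset.prod_congr rfl fun i _ => ?_
    rw [hmod, pow_mul, Polynomial.map_sub, map_X, map_C]
    rfl
  have hlift : (∏ i ∈ Z, (X - C (β ^ i))) ∈ lifts (algebraMap K L) := by
    rw [lifts_iff_coeff_lifts]
    intro k
    apply mem_range_of_pow_card_eq
    conv_rhs => rw [← hfix]
    rw [coeff_map]
    rfl
  obtain ⟨P, h1, h2, h3⟩ := lifts_and_natDegree_eq_and_monic hlift hmonic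
  refine ⟨P, h1, ?_, h3⟩
  rw [h2, natDegree_prod_of_monic _ _ fun i _ => monic_X_sub_C _]
  simp only [natDegree_X_sub_C, Finset.sum_const, smul_eq_mul, mul_one]

theorem dvd_iff_forall_aeval {Z : Finset ℕ} (hβ : IsPrimitiveRoot β n) (hZn : ∀ i ∈ Z, i < n)
    {P : K[X]} (hP : P.map (algebraMap K L) = ∏ i ∈ Z, (X - C (β ^ i))) (p : K[X]) :
    P ∣ p ↔ ∀ i ∈ Z, aeval (β ^ i) p = 0 := by
  rw [← Polynomial.map_dvd_map' (algebraMap K L), hP]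
  simp only [← eval_map_algebraMap]
  constructor
  · intro h i hi
    have := (Finset.dvd_prod_of_mem (fun i => X - C (β ^ i)) hi).trans h
    exact dvd_iff_isRoot.mp this
  · intro h
    apply Finset.prod_dvd_of_coprime
    · intro i hi j hj hij
      apply isCoprime_X_sub_C_of_isUnit_sub
      rw [isUnit_iff_ne_zero, sub_ne_zero]
      exact fun he => hij (hβ.pow_inj (hZn i hi) (hZn j hj) he)
    · intro i hi
      exact dvd_iff_isRoot.mpr (h i hi)

/-- The code is the kernel of reduction modulo P, which maps words of length n onto K[X]/(P) because
deg P ≤ n. -/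
theorem finrank_of_dvd {P : K[X]} (hP : P.Monic) (hdeg : P.natDegree ≤ n)
    (C : Submodule K (Fin n → K)) (hC : ∀ c, c ∈ C ↔ P ∣ wordPoly c) :
    Module.finrank K C = n - P.natDegree := by
  let ψ : (Fin n → K) →ₗ[K] AdjoinRoot P :=
    { toFun := fun c => AdjoinRoot.mk P (wordPoly c)
      map_add' := fun a b => by rw [wordPoly_add, map_add]
      map_smul' := fun r a => by
        rw [wordPoly_smul, map_mul, AdjoinRoot.mk_C, RingHom.id_apply, Algebra.smul_def]
        rfl }
  have hker : LinearMap.ker ψ = C := by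
    ext c
    rw [LinearMap.mem_ker, hC]
    exact AdjoinRoot.mk_eq_zero
  have hsurj : Function.Surjective ψ := by
    intro x
    obtain ⟨f, rfl⟩ := AdjoinRoot.mk_surjective x
    refine ⟨fun i => (f %ₘ P).coeff i, ?_⟩
    change AdjoinRoot.mk P (wordPoly _) = _
    rw [wordPoly_coeff _ ((degree_modByMonic_lt f hP).trans_le
      (degree_le_of_natDegree_le hdeg)), AdjoinRoot.mk_eq_mk,
      modByMonic_eq_sub_mul_div, sub_sub_cancel_left, dvd_neg]
    exact dvd_mul_right _ _
  have h1 := LinearMap.finrank_range_add_finrank_ker ψ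
  rw [LinearMap.range_eq_top.mpr hsurj, finrank_top, hker, Module.finrank_fintype_fun_eq_card,
    Fintype.card_fin] at h1
  have h2 : Module.finrank K (AdjoinRoot P) = P.natDegree := finrank_quotient_span_eq_natDegree
  omega

theorem finrank_of_zeros [Fintype K] (hβ : IsPrimitiveRoot β n)
    (hcop : Nat.Coprime n (Fintype.card K)) (Z : Finset ℕ) (hZn : ∀ i ∈ Z, i < n)
    (hZ : ∀ i ∈ Z, i * Fintype.card K % n ∈ Z) (C : Submodule K (Fin n → K))
    (hC : ∀ c, c ∈ C ↔ ∀ i ∈ Z, aeval (β ^ i) (wordPoly c) = 0) :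
    Module.finrank K C = n - Z.card := by
  obtain ⟨P, h1, h2, h3⟩ := exists_map_eq_prod hβ hcop Z hZn hZ
  rw [← h2]
  apply finrank_of_dvd h3
  · rw [h2]
    have : Z ⊆ Finset.range n := fun i hi => Finset.mem_range.mpr (hZn i hi)
    simpa using Finset.card_le_card this
  · intro c
    rw [hC, dvd_iff_forall_aeval hβ hZn h1]

/-- A cyclic code contains a word that vanishes at the prescribed zeros only. -/
theorem exists_mem_aeval_ne_zero [Fintype K] (hβ : IsPrimitiveRoot β n)
    (hcop : Nat.Coprime n (Fintype.card K)) (Z : Finset ℕ) (hZn : ∀ i ∈ Z, i < n)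
    (hZ : ∀ i ∈ Z, i * Fintype.card K % n ∈ Z) {i : ℕ} (hi : i < n) (hiZ : i ∉ Z) :
    ∃ c : Fin n → K, (∀ j ∈ Z, aeval (β ^ j) (wordPoly c) = 0) ∧
      aeval (β ^ i) (wordPoly c) ≠ 0 := by
  obtain ⟨P, h1, h2, h3⟩ := exists_map_eq_prod hβ hcop Z hZn hZ
  have hlt : P.natDegree < n := by
    rw [h2]
    have : Z ⊂ Finset.range n := by
      rw [Finset.ssubset_iff_of_subset fun i hi => Finset.mem_range.mpr (hZn i hi)]
      exact ⟨i, Finset.mem_range.mpr hi, hiZ⟩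
    simpa using Finset.card_lt_card this
  refine ⟨fun k => P.coeff k, ?_, ?_⟩
  · rw [wordPoly_coeff P ((natDegree_lt_iff_degree_lt h3.ne_zero).mp hlt)]
    exact (dvd_iff_forall_aeval hβ hZn h1 P).mp dvd_rfl
  · rw [wordPoly_coeff P ((natDegree_lt_iff_degree_lt h3.ne_zero).mp hlt),
      ← eval_map_algebraMap, h1,
      eval_prod, Finset.prod_ne_zero_iff]
    intro j hj
    rw [eval_sub, eval_X, eval_C, sub_ne_zero]
    intro he
    exact hiZ (hβ.pow_inj hi (hZn j hj) he ▸ hj)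

theorem eq_zero_of_forall_aeval (hβ : IsPrimitiveRoot β n) {c : Fin n → K}
    (h : ∀ i < n, aeval (β ^ i) (wordPoly c) = 0) : c = 0 := by
  classical
  apply wordPoly_eq_zero
  have hd := wordPoly_degree_lt c
  by_contra h0
  have h1 : (wordPoly c).map (algebraMap K L) ≠ 0 :=
    (Polynomial.map_ne_zero_iff (algebraMap K L).injective).mpr h0
  have h2 := Polynomial.card_le_degree_of_subset_roots (p := (wordPoly c).map (algebraMap K L))
    (Z := (Finset.range n).image fun i => β ^ i) (by
      intro x hx
      obtain ⟨i, hi, rfl⟩ := Finset.mem_image.mp (Finset.mem_val.mp hx)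
      rw [mem_roots h1, IsRoot.def, eval_map_algebraMap]
      exact h i (Finset.mem_range.mp hi))
  rw [Finset.card_image_of_injOn, Finset.card_range, natDegree_map] at h2
  · have := (natDegree_lt_iff_degree_lt h0).mpr hd
    omega
  · intro i hi j hj hij
    simp only [Finset.coe_range, Set.mem_Iio] at hi hj
    exact hβ.pow_inj hi hj hij

/-- Cyclic shifts multiply the values of a word by roots of unity. -/
theorem aeval_shift [NeZero n] (hβ : β ^ n = 1) (y : Fin n → K) (t : Fin n) (i : ℕ) :
    (β ^ i) ^ (t : ℕ) * aeval (β ^ i) (wordPoly fun k => y (k + t)) =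
      aeval (β ^ i) (wordPoly y) := by
  rw [aeval_wordPoly, aeval_wordPoly, Finset.mul_sum,
    ← Equiv.sum_comp (Equiv.addRight t) (fun k => algebraMap K L (y k) * (β ^ i) ^ (k : ℕ))]
  refine Finset.sum_congr rfl fun k _ => ?_
  have h1 : (β ^ i) ^ n = 1 := by rw [← pow_mul, mul_comm, pow_mul, hβ, one_pow]
  rw [Equiv.coe_addRight, Fin.val_add, ← pow_eq_pow_mod _ h1, pow_add]
  ring

/-- A word x in the code and its dual vanishes at Z. For i outside Z, -i is also outside Z, so some
codeword y is nonzero at β^(-i); orthogonality to all cyclic shifts of y then forces x(β^i) = 0. -/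
theorem isLCD_of_zeros [Fintype K] (hn : 0 < n) (hβ : IsPrimitiveRoot β n)
    (hcop : Nat.Coprime n (Fintype.card K)) (Z : Finset ℕ) (hZn : ∀ i ∈ Z, i < n)
    (hZ : ∀ i ∈ Z, i * Fintype.card K % n ∈ Z) (hneg : ∀ i < n, i ∉ Z → (n - i) % n ∉ Z)
    (C : Submodule K (Fin n → K))
    (hC : ∀ c, c ∈ C ↔ ∀ i ∈ Z, aeval (β ^ i) (wordPoly c) = 0) : IsLCD C := by
  have : NeZero n := ⟨hn.ne'⟩
  have h1 := hβ.pow_eq_one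
  rw [IsLCD, Submodule.eq_bot_iff]
  intro x hx
  obtain ⟨hx1, hx2⟩ := Submodule.mem_inf.mp hx
  apply eq_zero_of_forall_aeval hβ
  intro i hi
  by_cases hiZ : i ∈ Z
  · exact (hC x).mp hx1 i hiZ
  obtain ⟨y, hy1, hy2⟩ := exists_mem_aeval_ne_zero hβ hcop Z hZn hZ (Nat.mod_lt (n - i) hn)
    (hneg i hi hiZ)
  have hinv : β ^ ((n - i) % n) * β ^ i = 1 := by
    rw [← pow_eq_pow_mod _ h1, ← pow_add, Nat.sub_add_cancel hi.le, h1]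
  set γ := β ^ ((n - i) % n)
  have hshift : ∀ t : Fin n, (fun k => y (k + t)) ∈ C := by
    intro t
    rw [hC]
    intro j hj
    have := aeval_shift h1 y t j
    rw [hy1 j hj] at this
    refine (mul_eq_zero.mp this).resolve_left (pow_ne_zero _ (pow_ne_zero _ ?_))
    exact hβ.ne_zero hn.ne'
  have horth : ∀ t : Fin n, ∑ k, algebraMap K L (x k) * algebraMap K L (y (k + t)) = 0 := by
    intro t
    have : x ⬝ᵥ (fun k => y (k + t)) = 0 := hx2 _ (hshift t)
    rw [dotProduct] at this
    rw [← map_zero (algebraMap K L), ← this, map_sum]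
    simp only [map_mul]
  -- The product is the discrete Fourier transform, over the shift t, of the inner products of x
  -- with the shifts of y.
  have key : aeval (β ^ i) (wordPoly x) * aeval γ (wordPoly y) = 0 := by
    have h2 : ∑ t : Fin n,
        γ ^ (t : ℕ) * ∑ k, algebraMap K L (x k) * algebraMap K L (y (k + t)) = 0 :=
      Finset.sum_eq_zero fun t _ => by rw [horth, mul_zero]
    rw [← h2]
    simp only [Finset.mul_sum]
    rw [Finset.sum_comm, aeval_wordPoly, Finset.sum_mul]
    refine Finset.sum_congr rfl fun k _ => ?_
    rw [← aeval_shift h1 y k, aeval_wordPoly, Finset.mul_sum, Finset.mul_sum]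
    refine Finset.sum_congr rfl fun t _ => ?_
    rw [add_comm t k]
    have : (β ^ i) ^ (k : ℕ) * γ ^ (k : ℕ) = 1 := by
      rw [← mul_pow, mul_comm, hinv, one_pow]
    change _ * (β ^ i) ^ (k : ℕ) * (γ ^ (k : ℕ) * (_ * γ ^ (t : ℕ))) = _
    linear_combination (algebraMap K L (x k)) * (algebraMap K L (y (k + t))) * γ ^ (t : ℕ) * this
  exact (mul_eq_zero.mp key).resolve_right hy2

open Classical in
/-- The BCH bound for `2 δ - 1` consecutive zeros around `0`. -/
theorem two_mul_le_hammingNorm (hn : 0 < n) (hβ : IsPrimitiveRoot β n) {δ : ℕ}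
    {c : Fin n → K} (hc : c ≠ 0)
    (hpos : ∀ j < δ, aeval (β ^ j) (wordPoly c) = 0)
    (hneg : ∀ j < δ, aeval ((β ^ j)⁻¹) (wordPoly c) = 0) : 2 * δ ≤ hammingNorm c := by
  by_contra hlt
  obtain ⟨k₀, hk₀⟩ := Function.ne_iff.mp hc
  have hβ0 : β ≠ 0 := hβ.ne_zero hn.ne'
  let S : Finset (Fin n) := {k | c k ≠ 0}
  have hS : S.card < 2 * δ := by
    rw [hammingNorm] at hlt
    exact not_le.mp hlt
  have hk₀S : k₀ ∈ S := by simpa [S] using hk₀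
  -- The polynomial vanishing at all support locations but one. Its degree is below the number of
  -- consecutive zeros, so the weighted sum of c_k A(β^k) is zero, yet only the k₀ term survives.
  let A : L[X] := ∏ k ∈ S.erase k₀, (X - C (β ^ (k : ℕ)))
  have hA : A.natDegree < 2 * δ - 1 := by
    rw [natDegree_prod_of_monic _ _ fun i _ => monic_X_sub_C _]
    simp only [natDegree_X_sub_C, Finset.sum_const, smul_eq_mul, mul_one]
    rw [Finset.card_erase_of_mem hk₀S]
    have := Finset.card_pos.mpr ⟨k₀, hk₀S⟩
    omega
  have hz : ∀ l < 2 * δ - 1,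
      ∑ k : Fin n, algebraMap K L (c k) * ((β ^ (δ - 1))⁻¹ * β ^ l) ^ (k : ℕ) = 0 := by
    intro l hl
    rw [← aeval_wordPoly]
    rcases le_total (δ - 1) l with h | h
    · obtain ⟨r, rfl⟩ := Nat.exists_eq_add_of_le h
      rw [pow_add, inv_mul_cancel_left₀ (pow_ne_zero _ hβ0)]
      exact hpos r (by omega)
    · obtain ⟨r, hr⟩ := Nat.exists_eq_add_of_le h
      rw [hr, pow_add, mul_inv, mul_comm (β ^ l)⁻¹, inv_mul_cancel_right₀ (pow_ne_zero _ hβ0)]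
      exact hneg r (by omega)
  have h1 : ∑ k : Fin n,
      algebraMap K L (c k) * ((β ^ (δ - 1))⁻¹) ^ (k : ℕ) * A.eval (β ^ (k : ℕ)) = 0 := by
    simp only [eval_eq_sum_range' hA, Finset.mul_sum]
    rw [Finset.sum_comm]
    apply Finset.sum_eq_zero
    intro l hl
    rw [← mul_zero (A.coeff l), ← hz l (Finset.mem_range.mp hl), Finset.mul_sum]
    refine Finset.sum_congr rfl fun k _ => ?_
    rw [mul_pow, ← pow_mul β (k : ℕ) l, mul_comm (k : ℕ) l, pow_mul]
    ring
  rw [Finset.sum_eq_single k₀] at h1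
  · have h2 : A.eval (β ^ (k₀ : ℕ)) ≠ 0 := by
      rw [eval_prod, Finset.prod_ne_zero_iff]
      intro k hk
      rw [eval_sub, eval_X, eval_C, sub_ne_zero]
      intro he
      have := hβ.pow_inj k₀.2 k.2 he
      exact (Finset.mem_erase.mp hk).1 (Fin.ext this.symm)
    have h3 : algebraMap K L (c k₀) ≠ 0 := by
      simpa using hk₀
    have h4 : ((β ^ (δ - 1))⁻¹) ^ (k₀ : ℕ) ≠ 0 := pow_ne_zero _ (inv_ne_zero (pow_ne_zero _ hβ0))
    exact mul_ne_zero (mul_ne_zero h3 h4) h2 h1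
  · intro k _ hk
    by_cases hck : c k = 0
    · simp [hck]
    · have : A.eval (β ^ (k : ℕ)) = 0 := by
        rw [eval_prod]
        apply Finset.prod_eq_zero (i := k)
        · simp [S, hk, hck]
        · simp
      rw [this, mul_zero]
  · simp

/-- Positive dimension is needed: for the zero code the infimum is over the empty set and equals 0.
-/
theorem le_minDist {C : Submodule K (Fin n → K)} {d : ℕ} (h0 : 0 < Module.finrank K C)
    (h : ∀ c ∈ C, c ≠ 0 → ∀ [DecidableEq K], d ≤ hammingNorm c) : d ≤ minDist C := by
  classical
  apply le_csInf
  · have : Nontrivial C := Module.nontrivial_of_finrank_pos h0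
    obtain ⟨x, hx⟩ := exists_ne (0 : C)
    exact ⟨_, x, x.2, 0, C.zero_mem, by simpa using hx, rfl⟩
  · rintro _ ⟨x, hx, y, hy, hxy, rfl⟩
    rw [hammingDist_eq_hammingNorm]
    exact h _ (C.add_mem (C.neg_mem hx) hy) (by rwa [Ne, neg_add_eq_zero])

end Codes

/-! ### Cosets as a partition, and the parameters of the BCH codes -/

theorem mem_coset_symm {q n x s : ℕ} (hcop : Nat.Coprime q n) (hs : s < n)
    (h : x ∈ cyclotomicCoset q n s) : s ∈ cyclotomicCoset q n x := by
  obtain ⟨j, rfl⟩ := h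
  -- This exponent completes q^j to a power of q^φ(n) ≡ 1.
  refine ⟨j * n.totient - j, ?_⟩
  have h1 : 1 ≤ n.totient := Nat.totient_pos.mpr (by omega)
  have h2 : j ≤ j * n.totient := Nat.le_mul_of_pos_right _ h1
  have h3 : (q ^ n.totient) ^ j ≡ 1 [MOD n] := by
    simpa using (Nat.ModEq.pow_totient hcop).pow j
  rw [Nat.mod_mul_mod, mul_assoc, ← pow_add, Nat.add_sub_cancel' h2, mul_comm j, pow_mul]
  have := h3.mul_left s
  rw [mul_one, Nat.ModEq, Nat.mod_eq_of_lt hs] at this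
  exact this.symm

theorem mem_coset_trans {q n x y z : ℕ} (h : x ∈ cyclotomicCoset q n y)
    (h' : y ∈ cyclotomicCoset q n z) : x ∈ cyclotomicCoset q n z := by
  obtain ⟨j, rfl⟩ := h
  obtain ⟨i, rfl⟩ := h'
  exact ⟨i + j, by rw [Nat.mod_mul_mod, mul_assoc, ← pow_add]⟩

theorem lt_of_mem_coset {q n x s : ℕ} (hn : 0 < n) (h : x ∈ cyclotomicCoset q n s) : x < n := by
  obtain ⟨j, rfl⟩ := h
  exact Nat.mod_lt _ hn

theorem exists_leader {q n i : ℕ} (hcop : Nat.Coprime q n) (hi : i < n) :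
    ∃ t ∈ cosetLeaders q n, i ∈ cyclotomicCoset q n t ∧ t ∈ cyclotomicCoset q n i := by
  have hne : (cyclotomicCoset q n i).Nonempty := ⟨i, 0, by simp [Nat.mod_eq_of_lt hi]⟩
  have hmem := Nat.sInf_mem hne
  have h1 := mem_coset_symm hcop hi hmem
  have hlt := lt_of_mem_coset (by omega) hmem
  refine ⟨_, ⟨⟨0, by simp [Nat.mod_eq_of_lt hlt]⟩, fun x hx => ?_⟩, h1, hmem⟩
  exact Nat.sInf_le (mem_coset_trans hx hmem)

theorem leader_eq {q n x t t' : ℕ} (hcop : Nat.Coprime q n) (hn : 0 < n)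
    (ht : t ∈ cosetLeaders q n) (ht' : t' ∈ cosetLeaders q n)
    (h : x ∈ cyclotomicCoset q n t) (h' : x ∈ cyclotomicCoset q n t') : t = t' := by
  have e1 := mem_coset_symm hcop (lt_of_mem_coset hn ht.1) h
  have e2 := mem_coset_symm hcop (lt_of_mem_coset hn ht'.1) h'
  exact le_antisymm (ht.2 (mem_coset_trans e2 h)) (ht'.2 (mem_coset_trans e1 h'))

open Classical in
/-- The exponents of the roots of a BCH code. -/
noncomputable def bchZeros (q n δ : ℕ) : Finset ℕ :=
  {i ∈ Finset.range n | ∃ j < δ, i ∈ cyclotomicCoset q n j}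

theorem mem_bchZeros {q n δ i : ℕ} (hn : 0 < n) :
    i ∈ bchZeros q n δ ↔ ∃ j < δ, i ∈ cyclotomicCoset q n j := by
  simp only [bchZeros, Finset.mem_filter, Finset.mem_range, and_iff_right_iff_imp]
  rintro ⟨j, -, h⟩
  exact lt_of_mem_coset hn h

/-- The number of nonzeros is the sum of the sizes of the cosets with leader at least `δ`. -/
theorem card_sub_bchZeros {q n δ : ℕ} (hn : 0 < n) (hcop : Nat.Coprime q n) (T : Finset ℕ)
    (hT : ∀ t, t ∈ T ↔ t ∈ cosetLeaders q n ∧ δ ≤ t) :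
    n - (bchZeros q n δ).card = ∑ t ∈ T, (cyclotomicCoset q n t).ncard := by
  classical
  have hsub : bchZeros q n δ ⊆ Finset.range n := Finset.filter_subset _ _
  have hset : Finset.range n \ bchZeros q n δ =
      T.biUnion fun t => {i ∈ Finset.range n | i ∈ cyclotomicCoset q n t} := by
    ext i
    simp only [Finset.mem_sdiff, Finset.mem_range, Finset.mem_biUnion, Finset.mem_filter,
      mem_bchZeros hn, hT]
    constructor
    · rintro ⟨hi, h⟩
      obtain ⟨t, ht, h1, h2⟩ := exists_leader hcop hi
      refine ⟨t, ⟨ht, ?_⟩, hi, h1⟩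
      by_contra hlt
      exact h ⟨t, not_le.mp hlt, h1⟩
    · rintro ⟨t, ⟨ht, hδ⟩, hi, h⟩
      refine ⟨hi, ?_⟩
      rintro ⟨j, hj, hij⟩
      have hjn : j < n := by
        have := lt_of_mem_coset hn ht.1
        omega
      have h2 := mem_coset_trans (mem_coset_symm hcop hjn hij) h
      have := ht.2 h2
      omega
  have hcard : ∀ t, (cyclotomicCoset q n t).ncard =
      ({i ∈ Finset.range n | i ∈ cyclotomicCoset q n t} : Finset ℕ).card := by
    intro t
    rw [← Set.ncard_coe_finset]
    congr 1
    ext i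
    simp only [Finset.coe_filter, Finset.mem_range, Set.mem_ofPred_eq]
    exact ⟨fun h => ⟨lt_of_mem_coset hn h, h⟩, fun h => h.2⟩
  rw [← Finset.card_range n, ← Finset.card_sdiff_of_subset (by simpa using hsub),
    Finset.card_range, hset,
    Finset.card_biUnion]
  · exact Finset.sum_congr rfl fun t _ => (hcard t).symm
  · intro t ht t' ht' hne
    rw [Function.onFun, Finset.disjoint_left]
    intro i hi hi'
    exact hne (leader_eq hcop hn ((hT t).mp ht).1 ((hT t').mp ht').1
      (Finset.mem_filter.mp hi).2 (Finset.mem_filter.mp hi').2)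

/-- Designed distance δ + 1 prescribes the exponents 0, …, δ - 1. Since multiplication by q^m is
negation modulo n, the zero set is closed under negation, and the zeros -(δ-1), …, δ-1 give the
bound 2δ. -/
theorem bchCode_params {K : Type*} [Field K] [Fintype K] {L : Type*} [Field L] [Algebra K L]
    {m n : ℕ} {β : L} (hm : 0 < m) (hN : Fintype.card K ^ m + 1 = 2 * n)
    (hβ : IsPrimitiveRoot β n) (δ : ℕ) (T : Finset ℕ) (hTne : T.Nonempty)
    (hT : ∀ t, t ∈ T ↔ t ∈ cosetLeaders (Fintype.card K) n ∧ δ ≤ t) :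
    IsLCDWithParams (bchCode K n β (δ + 1) 0)
      (∑ t ∈ T, (cyclotomicCoset (Fintype.card K) n t).ncard) (2 * δ) := by
  classical
  have hn : 0 < n := by omega
  obtain ⟨q, hq⟩ : ∃ q, q = Fintype.card K := ⟨_, rfl⟩
  have hcop : Nat.Coprime n q := by
    rw [Nat.coprime_comm]
    apply Nat.Coprime.coprime_mul_left_right (k := 2)
    rw [← hN, ← hq]
    apply (Nat.coprime_add_iff_right (dvd_pow_self q hm.ne')).mpr
    exact Nat.coprime_one_right q
  have hZn : ∀ i ∈ bchZeros q n δ, i < n := fun i hi =>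
    Finset.mem_range.mp (Finset.mem_filter.mp hi).1
  have hZ : ∀ i ∈ bchZeros q n δ, i * q % n ∈ bchZeros q n δ := by
    intro i hi
    rw [mem_bchZeros hn] at hi ⊢
    obtain ⟨j, hj, h⟩ := hi
    exact ⟨j, hj, mem_coset_trans ⟨1, by rw [pow_one]⟩ h⟩
  have hqm : ∀ i ≤ n, (n - i) * q ^ m ≡ i [MOD n] := by
    intro i hi
    rw [← Int.natCast_modEq_iff, Int.modEq_iff_dvd]
    have h1 : (q : ℤ) ^ m = 2 * n - 1 := by
      have : (q : ℤ) ^ m + 1 = 2 * n := by rw [hq]; exact_mod_cast hN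
      linarith
    refine ⟨1 - 2 * (n - i), ?_⟩
    push_cast [Nat.cast_sub hi]
    rw [h1]; ring
  have hneg : ∀ i < n, i ∉ bchZeros q n δ → (n - i) % n ∉ bchZeros q n δ := by
    intro i hi hiZ hc
    rw [mem_bchZeros hn] at hiZ hc
    obtain ⟨j, hj, h⟩ := hc
    refine hiZ ⟨j, hj, mem_coset_trans ⟨m, ?_⟩ h⟩
    rw [Nat.mod_mul_mod, hqm i hi.le, Nat.mod_eq_of_lt hi]
  have hmod : ∀ i, β ^ (i % n) = β ^ i := fun i => (pow_eq_pow_mod i hβ.pow_eq_one).symm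
  have hpow : ∀ (p : K[X]) (j t : ℕ), aeval (β ^ j) p = 0 → aeval (β ^ (j * q ^ t)) p = 0 := by
    intro p j t h
    induction t with
    | zero => simpa using h
    | succ t ih =>
      rw [pow_succ, ← mul_assoc, pow_mul, hq]
      rw [hq] at ih
      exact aeval_pow_card ih
  have hC : ∀ c, c ∈ bchCode K n β (δ + 1) 0 ↔
      ∀ i ∈ bchZeros q n δ, aeval (β ^ i) (wordPoly c) = 0 := by
    intro c
    rw [mem_bchCode_iff hβ.pow_eq_one]
    constructor
    · intro h i hi
      obtain ⟨j, hj, t, rfl⟩ := (mem_bchZeros hn).mp hi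
      rw [hmod]
      exact hpow _ _ _ (h j hj)
    · intro h j hj
      rw [← hmod]
      exact h _ ((mem_bchZeros hn).mpr ⟨j, hj, 0, by simp⟩)
  have hrank := finrank_of_zeros hβ (hq ▸ hcop) (bchZeros q n δ) hZn (hq ▸ hZ) _ hC
  rw [card_sub_bchZeros hn hcop.symm T (by rw [hq]; exact hT)] at hrank
  rw [hq] at hrank
  refine ⟨isLCD_of_zeros hn hβ (hq ▸ hcop) (bchZeros q n δ) hZn (hq ▸ hZ) hneg _ hC, hrank, ?_⟩
  apply le_minDist
  · rw [hrank]
    obtain ⟨t, ht⟩ := hTne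
    refine Finset.sum_pos' (fun _ _ => Nat.zero_le _) ⟨t, ht, ?_⟩
    rw [Set.ncard_pos ((Set.finite_Iio n).subset fun x hx => lt_of_mem_coset hn hx)]
    exact ⟨t, ((hT t).mp ht).1.1⟩
  · intro c hc hc0 inst
    rw [Subsingleton.elim inst (Classical.decEq K)]
    have h0 := (mem_bchCode_iff hβ.pow_eq_one δ c).mp hc
    have := two_mul_le_hammingNorm hn hβ hc0 h0 (by
      intro j hj
      have h1 := hpow _ _ m (h0 j hj)
      have h2 : β ^ (j * q ^ m) * β ^ j = 1 := by
        rw [← pow_add, hq, show j * Fintype.card K ^ m + j = n * (2 * j) by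
          rw [← Nat.mul_succ, Nat.succ_eq_add_one, hN]; ring, pow_mul, hβ.pow_eq_one, one_pow]
      rwa [eq_inv_of_mul_eq_one_left h2] at h1)
    convert this

theorem mainTheorem8 (q m ν : ℕ) (hq : IsPrimePow q) (hodd : Odd q)
    (hν : ν = padicValNat 2 m) (hν12 : ν = 1 ∨ ν = 2)
    (hmod : m ≡ 2 ^ ν [MOD 2 ^ (ν + 1)]) (hm : 2 ^ ν + 2 ^ (ν + 1) ≤ m) :
    ∃ D₂ D₃ D₄ d₁ d₂ d₃ : ℕ,
      -- the second, third and fourth largest coset leaders modulo `q ^ m + 1`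
      (IsNthLargestCosetLeader q (q ^ m + 1) 2 D₂ ∧
        IsNthLargestCosetLeader q (q ^ m + 1) 3 D₃ ∧
        IsNthLargestCosetLeader q (q ^ m + 1) 4 D₄) ∧
      ((D₂ : ℚ) = ((q : ℚ) ^ m + 1) / ((q : ℚ) ^ (2 ^ ν) + 1) * Psi q ((ν : ℤ) - 1) ∧
        (D₃ : ℚ) = (D₂ : ℚ) - 2 * (((D₂ : ℚ) + Psi q (ν : ℤ)) / (q : ℚ) ^ (2 ^ (ν + 1))) ∧
        (D₄ : ℚ) = if m = 2 ^ ν + 2 ^ (ν + 1)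
          then (D₃ : ℚ) - 2 * (q : ℚ) ^ (2 ^ (ν - 1)) * Psi q ((ν : ℤ) - 1)
          else (D₃ : ℚ) - 2 * Psi q (ν : ℤ)) ∧
      -- the three largest coset leaders modulo `(q ^ m + 1) / 2` and the sizes of their cosets
      (IsNthLargestCosetLeader q ((q ^ m + 1) / 2) 1 d₁ ∧
        IsNthLargestCosetLeader q ((q ^ m + 1) / 2) 2 d₂ ∧
        IsNthLargestCosetLeader q ((q ^ m + 1) / 2) 3 d₃) ∧
      (D₂ = 2 * d₁ ∧ D₃ = 2 * d₂ ∧ D₄ = 2 * d₃) ∧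
      ((cyclotomicCoset q ((q ^ m + 1) / 2) d₁).ncard = 2 ^ (ν + 1) ∧
        (cyclotomicCoset q ((q ^ m + 1) / 2) d₂).ncard = 2 * m ∧
        (cyclotomicCoset q ((q ^ m + 1) / 2) d₃).ncard = 2 * m) ∧
      -- the BCH codes
      ∀ (K : Type*) [Field K] [Fintype K] (_ : Fintype.card K = q)
        (L : Type*) [Field L] [Algebra K L] (β : L) (_ : IsPrimitiveRoot β ((q ^ m + 1) / 2)),
        (∀ δ : ℕ, d₂ + 1 ≤ δ → δ ≤ d₁ →
          IsLCDWithParams (bchCode K ((q ^ m + 1) / 2) β (δ + 1) 0) (2 ^ (ν + 1)) (2 * δ)) ∧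
        (∀ δ : ℕ, d₃ + 1 ≤ δ → δ ≤ d₂ →
          IsLCDWithParams (bchCode K ((q ^ m + 1) / 2) β (δ + 1) 0)
            (2 * m + 2 ^ (ν + 1)) (2 * δ)) ∧
        IsLCDWithParams (bchCode K ((q ^ m + 1) / 2) β (d₃ + 1) 0)
          (4 * m + 2 ^ (ν + 1)) (2 * d₃) := by
  have hq3 : 3 ≤ q := by
    have := hq.one_lt
    obtain ⟨k, rfl⟩ := hodd
    omega
  obtain ⟨p, hp, h3, hmp⟩ : ∃ p, p % 2 = 1 ∧ 3 ≤ p ∧ m = 2 ^ ν * p := by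
    rcases hν12 with rfl | rfl
    · simp only [Nat.ModEq] at hmod
      norm_num at hmod hm
      exact ⟨m / 2, by omega, by omega, by norm_num; omega⟩
    · simp only [Nat.ModEq] at hmod
      norm_num at hmod hm
      exact ⟨m / 4, by omega, by omega, by norm_num; omega⟩
  have hm0 : 0 < m := by
    have : 0 < 2 ^ ν := by positivity
    omega
  obtain ⟨r, hr⟩ : ∃ r, m = 2 * r := by
    rcases hν12 with rfl | rfl
    · exact ⟨p, by simpa using hmp⟩
    · exact ⟨2 * p, by rw [hmp]; ring⟩
  obtain ⟨n, hN, hnodd⟩ : ∃ n, q ^ m + 1 = 2 * n ∧ Odd n := by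
    obtain ⟨k, hk⟩ := hodd.pow (n := r)
    -- As m = 2r, q^m is the square of the odd number q^r = k + k + 1, so q^m + 1 is twice an odd
    -- number.
    refine ⟨2 * (k * k + k) + 1, ?_, ⟨_, rfl⟩⟩
    rw [hr, mul_comm 2 r, pow_mul, hk]; ring
  have hhalf : (q ^ m + 1) / 2 = n := by omega
  rw [hhalf, hN]
  obtain ⟨e₁, e₂, e₃, hF, s1, s2, s3, v1, v2, v3⟩ := exists_words (m := m) hq3 hν12 hp h3 hmp
  -- The value is (q-1) times an integer plus 1, hence odd like n, so the leader n - `wordVal q m e`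
  -- is even.
  have hex : ∀ e, e 0 = false → ∃ d : ℕ, ((2 * d : ℕ) : ℤ) = n - wordVal q m e := by
    intro e he
    have h1 := wordVal_lt_half hq3 hm0 hN he
    obtain ⟨k, hk⟩ := hnodd
    obtain ⟨l, hl⟩ := hodd
    have h2 : wordVal q m e = 2 * (l * wordSum q m e) + 1 := by
      rw [wordVal, hl]; push_cast; ring
    generalize (l : ℤ) * wordSum q m e = y at h2
    exact ⟨((k : ℤ) - y).toNat, by omega⟩
  obtain ⟨d₁, h1⟩ := hex e₁ hF.top₁.zero
  obtain ⟨d₂, h2⟩ := hex e₂ hF.top₂.zero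
  obtain ⟨d₃, h3⟩ := hex e₃ hF.top₃.zero
  have hdef : ∀ (e : ℕ → Bool) (d : ℕ), ((2 * d : ℕ) : ℤ) = n - wordVal q m e →
      wordDefect q m e = ((2 * d : ℕ) : ℚ) := by
    intro e d h
    have h' : ((2 * d : ℕ) : ℚ) = n - wordVal q m e := by exact_mod_cast h
    have hN' : (q : ℚ) ^ m + 1 = 2 * n := by exact_mod_cast hN
    rw [wordDefect, h', hN']; ring
  rw [hdef e₁ d₁ h1] at v1 v2
  rw [hdef e₂ d₂ h2] at v2 v3
  rw [hdef e₃ d₃ h3] at v3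
  obtain ⟨hL, hlt, hall⟩ := leaders_of_firstThree hq3 hodd hm0 hN hF h1 h2 h3
  obtain ⟨hL', hall'⟩ := firstLeaders_half hnodd hL hall
  have ha1 : IsAnti m e₁ := hF.top₁.anti
  have c1 : (cyclotomicCoset q n d₁).ncard = 2 ^ (ν + 1) := by
    rw [ncard_cyclotomicCoset hq3 hodd hm0 hN (by positivity) s1 ha1 h1, pow_succ]; ring
  have c2 := ncard_cyclotomicCoset hq3 hodd hm0 hN hm0 s2 hF.top₂.anti h2
  have c3 := ncard_cyclotomicCoset hq3 hodd hm0 hN hm0 s3 hF.top₃.anti h3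
  refine ⟨2 * d₁, 2 * d₂, 2 * d₃, d₁, d₂, d₃, isNthLargest_two_mul hodd hnodd.pos hL hlt hall,
    ⟨v1, v2, v3⟩, isNthLargest_half hL' hall', ⟨rfl, rfl, rfl⟩, ⟨c1, c2, c3⟩, ?_⟩
  obtain ⟨m1, m2, m3, l1, l2⟩ := hL'
  intro K _ _ hK L _ _ β hβ
  subst hK
  have hcodes := bchCode_params hm0 hN hβ
  refine ⟨fun δ hδ hδ' => ?_, fun δ hδ hδ' => ?_, ?_⟩
  · have := hcodes δ {d₁} (Finset.singleton_nonempty _) (by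
      intro t
      rw [Finset.mem_singleton]
      constructor
      · rintro rfl
        exact ⟨m1, hδ'⟩
      · rintro ⟨ht, hδt⟩
        have := hall' t ht (by omega)
        omega)
    rwa [Finset.sum_singleton, c1] at this
  · have := hcodes δ {d₂, d₁} (Finset.insert_nonempty _ _) (by
      intro t
      rw [Finset.mem_insert, Finset.mem_singleton]
      constructor
      · rintro (rfl | rfl)
        exacts [⟨m2, hδ'⟩, ⟨m1, by omega⟩]
      · rintro ⟨ht, hδt⟩
        have := hall' t ht (by omega)
        omega)
    rwa [Finset.sum_pair (by omega), c1, c2] at this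
  · have := hcodes d₃ {d₃, d₂, d₁} (Finset.insert_nonempty _ _) (by
      intro t
      rw [Finset.mem_insert, Finset.mem_insert, Finset.mem_singleton]
      constructor
      · rintro (rfl | rfl | rfl)
        exacts [⟨m3, le_rfl⟩, ⟨m2, by omega⟩, ⟨m1, by omega⟩]
      · rintro ⟨ht, hδt⟩
        have := hall' t ht (by omega)
        omega)
    rw [Finset.sum_insert (by simp; omega), Finset.sum_pair (by omega), c1, c2, c3] at this
    rwa [show 2 * m + (2 * m + 2 ^ (ν + 1)) = 4 * m + 2 ^ (ν + 1) by ring] at this
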